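/- Let $\Xi$ be the set of finite binary sequences, $\Omega=\{0,1\}^{\mathbb N}$, let $\omega^n$ be the initial segment of length $n$ of $\omega\in\Omega$, and $\Gamma_x=\{\omega\in\Omega: x\subseteq\omega\}$ for $x\in\Xi$. A semimeasure is a function $P:\Xi\to[0,\infty)$ with $P(\Lambda)\le 1$ and $P(x0)+P(x1)\le P(x)$ for all $x$; it is lower semicomputable if $\{(r,x): r\in\mathbb Q,\ r<P(x)\}$ is recursively enumerable. Let $M$ be an a priori semimeasure, i.e. a lower semicomputable semimeasure such that for every lower semicomputable semimeasure $P$ there is a constant $c>0$ with $P(x)\le cM(x)$ for all $x$; let $\bar M$ be the greatest Borel measure on $\Omega$ with $\bar M(\Gamma_x)\le M(x)$ for all $x$. A parameter $\theta$ is an element $\theta_1\theta_2\dots$ of $\Omega$, and it is associated with the real number $0.\theta_1\theta_2\ldots\in[0,1]$; $\theta$ is computable if this sequence is. A family $(P_\theta)_{\theta\in\Omega}$ of Borel probability measures on $\Omega$ is computable if one algorithm that uses $\theta$ as an oracle enumerates, for every $\theta$, exactly the triples $(x,r_1,r_2)\in\Xi\times\mathbb Q\times\mathbb Q$ with $r_1<P_\theta(\Gamma_x)<r_2$,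 each on the basis of a finite initial segment of $\theta$. (A family indexed by real numbers in $[0,1]$ is the special case in which $P_\theta$ depends only on $0.\theta_1\theta_2\ldots$.) Parametric lower semicomputable semimeasures $R_\theta$ are defined in the same way, with pairs $(r,x)$ such that $r<R_\theta(x)$; let $M_\theta$ be a universal one: for every parametric lower semicomputable semimeasure $R_\theta$ there is a constant $c>0$ with $R_\theta(x)\le cM_\theta(x)$ for all $x$ and $\theta$. Let $$I_\theta=\Big\{\omega\in\Omega:\ \sup_n \frac{M_\theta(\omega^n)}{P_\theta(\Gamma_{\omega^n})}<\infty\Big\}$$ be the set of $P_\theta$-random sequences (a positive number divided by $0$ is $\infty$). An estimator $\hat\theta:\Xi\to[0,1]$ is effectively strictly consistent for $(P_\theta)$ if there is a computable function $N(\epsilon,\delta)$ of positive rationals such that for all $\theta$, $\epsilon$, $\delta$ $$P_\theta\Big\{\omega:\ \sup_{n\ge N(\epsilon,\delta)}|\hat\theta(\omega^n)-0.\theta_1\theta_2\ldots|>\epsilon\Big\}\le\delta .$$ Theorem. Let $(P_\theta)_{\theta\in\Omega}$ be a computable parametric family of probability distributions that has an effectively strictly consistent estimator. Then for every $\theta$,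 $\bar M(I_\theta)>0$ if and only if $\theta$ is computable. -/

import Mathlib

open MeasureTheory
open scoped NNReal ENNReal

noncomputable section

namespace AlgRandom

/-- The space `Ω` of infinite binary sequences, with the product (= Borel) σ-algebra.
Parameters are also elements of `Ω`, see `value`. -/
abbrev BinSeq : Type := ℕ → Bool

/-- The finite binary sequence `ωⁿ`, the first `n` bits of `ω`. -/
def initSeg (ω : BinSeq) (n : ℕ) : List Bool := (List.range n).map ω

/-- The interval `Γ_x`: all infinite sequences that extend `x`. -/
def interval (x : List Bool) : Set BinSeq := {ω | initSeg ω x.length = x}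

/-- The real number `0.θ₁θ₂… ∈ [0,1]` with the binary expansion `θ`. -/
def value (θ : BinSeq) : ℝ := ∑' i : ℕ, (if θ i then (1 : ℝ) else 0) * (1 / 2) ^ (i + 1)

/-- Coding of rational numbers: `(a, b, c)` is a name of `(a - b) / (c + 1)`.
Every rational number has a name, and equality and order of named numbers are decidable. -/
def ratOf (q : ℕ × ℕ × ℕ) : ℚ := ((q.1 : ℚ) - (q.2.1 : ℚ)) / ((q.2.2 : ℚ) + 1)

/-- The two inequalities of a semimeasure, for a nonnegative real function on finite sequences. -/
structure IsSemimeasure (P : List Bool → ℝ≥0) : Prop where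
  root_le : P [] ≤ 1
  split_le : ∀ x, P (x ++ [false]) + P (x ++ [true]) ≤ P x

/-- Semicomputability from below: `{(r, x) : r < P x}`, `r` rational, is recursively enumerable. -/
def LowerSemicomputable (P : List Bool → ℝ≥0) : Prop :=
  REPred fun p : (ℕ × ℕ × ℕ) × List Bool => (ratOf p.1 : ℝ) < (P p.2 : ℝ)

/-- `M` is an a priori (universal) semimeasure: maximal, to within a positive constant factor,
among the semimeasures semicomputable from below. -/
structure IsUniversal (M : List Bool → ℝ≥0) : Prop where
  semimeasure : IsSemimeasure M
  lower : LowerSemicomputable M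
  maximal : ∀ P : List Bool → ℝ≥0, IsSemimeasure P → LowerSemicomputable P →
    ∃ c : ℝ≥0, 0 < c ∧ ∀ x, P x ≤ c * M x

/-- The maximal Borel measure `P̄` with `P̄ ≤ P` (that is, `P̄ (Γ_x) ≤ P x` for all `x`).
Finite measures that are ordered on all intervals are ordered on all Borel sets, so for a
semimeasure `P` the supremum is the greatest element of this set of measures, and
`P̄ (Γ_x) = inf_n ∑_{l(y) = n, x ⊆ y} P y`. -/
def bar (P : List Bool → ℝ≥0) : Measure BinSeq :=
  sSup {μ : Measure BinSeq | ∀ x, μ (interval x) ≤ (P x : ℝ≥0∞)}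

/-- Semicomputability from below uniformly in the parameter: one algorithm with the infinite
sequence `θ` as an additional input enumerates all pairs `(r, x)` with `r < R_θ(x)`, where each
pair is enumerated on the ground of a finite initial fragment of `θ`. -/
def ParamLowerSemicomputable (R : BinSeq → List Bool → ℝ≥0) : Prop :=
  ∃ W : List Bool × (ℕ × ℕ × ℕ) × List Bool → Prop, REPred W ∧
    ∀ θ q x, (ratOf q : ℝ) < (R θ x : ℝ) ↔ ∃ n, W (initSeg θ n, q, x)

/-- `M_θ` is a universal parametric semimeasure semicomputable from below; the constant does not
depend on the parameter. -/
structure IsParamUniversal (M : BinSeq → List Bool → ℝ≥0) : Prop where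
  semimeasure : ∀ θ, IsSemimeasure (M θ)
  lower : ParamLowerSemicomputable M
  maximal : ∀ R : BinSeq → List Bool → ℝ≥0, (∀ θ, IsSemimeasure (R θ)) →
    ParamLowerSemicomputable R → ∃ c : ℝ≥0, 0 < c ∧ ∀ θ x, R θ x ≤ c * M θ x

/-- `P_θ` is a computable parametric family of probability distributions: one algorithm with the
infinite sequence `θ` as an additional input enumerates all triples `(x, r₁, r₂)` with
`r₁ < P_θ(x) < r₂`, where each triple is enumerated on the ground of a finite initial fragment
of `θ`. -/
structure IsComputableFamily (P : BinSeq → Measure BinSeq) : Prop where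
  prob : ∀ θ, IsProbabilityMeasure (P θ)
  computable : ∃ W : List Bool × List Bool × (ℕ × ℕ × ℕ) × (ℕ × ℕ × ℕ) → Prop, REPred W ∧
    ∀ θ x q₁ q₂, ((ratOf q₁ : ℝ) < (P θ).real (interval x) ∧
      (P θ).real (interval x) < (ratOf q₂ : ℝ)) ↔ ∃ n, W (initSeg θ n, x, q₁, q₂)

/-- The deficiency of randomness `d_θ(ω) = sup_n M_θ(ωⁿ) / P_θ(ωⁿ)` (a positive number divided
by `0` is `∞`). -/
def deficiency (M : BinSeq → List Bool → ℝ≥0) (P : BinSeq → Measure BinSeq)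
    (θ ω : BinSeq) : ℝ≥0∞ :=
  ⨆ n : ℕ, (M θ (initSeg ω n) : ℝ≥0∞) / P θ (interval (initSeg ω n))

/-- The set `I_θ` of all sequences random with respect to `P_θ`. -/
def randomSet (M : BinSeq → List Bool → ℝ≥0) (P : BinSeq → Measure BinSeq)
    (θ : BinSeq) : Set BinSeq :=
  {ω | deficiency M P θ ω < ∞}

/-- The estimator `est` is effectively strictly consistent for `P_θ`: there is a computable
function `N(ε, δ)` of positive rationals such that for every parameter `θ`
`P_θ {ω : sup_{n ≥ N(ε, δ)} |est(ωⁿ) - θ| > ε} ≤ δ`. -/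
def EffectivelyStrictlyConsistent (P : BinSeq → Measure BinSeq)
    (est : List Bool → Set.Icc (0 : ℝ) 1) : Prop :=
  ∃ N : ℚ → ℚ → ℕ,
    Computable (fun q : (ℕ × ℕ × ℕ) × (ℕ × ℕ × ℕ) => N (ratOf q.1) (ratOf q.2)) ∧
    ∀ (θ : BinSeq) (ε δ : ℚ), 0 < ε → 0 < δ →
      (P θ).real {ω | ∃ n, N ε δ ≤ n ∧ (ε : ℝ) < |(est (initSeg ω n) : ℝ) - value θ|} ≤ (δ : ℝ)

end AlgRandom

end

open AlgRandom

/-! Suppose `θ` is computable. Then `P θ` is itself a lower semicomputable semimeasure, so `P θ ≤ c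
* M` on intervals and `c⁻¹ • P θ` is one of the measures below `bar M`. The random set has positive
`P θ`-measure by a maximal inequality: the supermartingale `Mpar θ / P θ` exceeds `2` with
probability at most one half (`measure_randomSet_pos`, `bar_randomSet_pos`).

For the converse, the estimator is replaced by finite tables. For each `k` some table on strings of
one length gives, for every `θ` and with high `P θ`-probability, the integer `binNum (initSeg θ k)`
to within `2`. Being good for all `θ` is an enumerable property because the parameter space is
compact, so such tables can be found by search, even though the estimator itself need not be
computable (`exists_computable_tables`). Weighting the error event of table `k` by `2 ^ k` gives a
parametric semimeasure, hence on a random sequence all but finitely many tables are correct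
(`exists_forall_correct`).

If `bar M` is positive on the random set, it is positive on a set `E` of sequences for which all
tables from some `K` on are correct. Cover `E` by intervals of total `M`-mass below `2p`, where
every cover of `E` has mass above `p`. Among the strings of the cover, those whose table entry is
near the true numeral still cover `E` and so have mass above `p`. Numerals more than `4` apart are
supported by disjoint sets of strings, and two such masses do not fit below `2p`. So any numeral
found with support above `p` approximates the true one (`exists_computable_near`). This computes the
real number of `θ`, and therefore its digits (`computable_of_near`). -/

noncomputable section

namespace AlgRandom

/-- A monotone sequence of predicates that holds eventually at each member of a list holds
uniformly on the list. -/
theorem forall_mem_exists_of_monotone {β : Type*} {p : ℕ → β → Prop}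
    (hmono : ∀ b s t, s ≤ t → p s b → p t b) (L : List β) (h : ∀ b ∈ L, ∃ s, p s b) :
    ∃ s, ∀ b ∈ L, p s b := by
  induction L with
  | nil => exact ⟨0, by simp⟩
  | cons b L ih =>
    obtain ⟨s, hs⟩ := ih fun c hc => h c (List.mem_cons_of_mem _ hc)
    obtain ⟨t, ht⟩ := h b List.mem_cons_self
    refine ⟨max s t, fun c hc => ?_⟩
    rcases List.mem_cons.1 hc with rfl | hc
    · exact hmono _ _ _ (le_max_right _ _) ht
    · exact hmono _ _ _ (le_max_left _ _) (hs c hc)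

/-! ### Closure properties of recursively enumerable predicates. -/

section Enumerability

variable {α β : Type*} [Primcodable α] [Primcodable β]

/-- Kleene normal form of a recursively enumerable predicate. -/
theorem exists_primrec_of_rePred {p : α → Prop} (hp : REPred p) :
    ∃ f : α × ℕ → Bool, Primrec f ∧ (∀ a s t, s ≤ t → f (a, s) = true → f (a, t) = true) ∧
      ∀ a, p a ↔ ∃ s, f (a, s) = true := by
  obtain ⟨c, hc⟩ := Nat.Partrec.Code.exists_code.1 hp
  refine ⟨fun x => (Nat.Partrec.Code.evaln x.2 c (Encodable.encode x.1)).isSome,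
    Primrec.option_isSome.comp (Nat.Partrec.Code.primrec_evaln.comp
      ((Primrec.snd.pair (Primrec.const c)).pair (Primrec.encode.comp Primrec.fst))), ?_, ?_⟩
  · intro a s t hst h
    obtain ⟨x, hx⟩ := Option.isSome_iff_exists.1 h
    exact Option.isSome_iff_exists.2 ⟨x, Nat.Partrec.Code.evaln_mono hst hx⟩
  · intro a
    have h1 : p a ↔ (Nat.Partrec.Code.eval c (Encodable.encode a)).Dom := by
      rw [hc]; simp [Part.assert]
    rw [h1, Part.dom_iff_mem]
    constructor
    · rintro ⟨y, hy⟩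
      obtain ⟨k, hk⟩ := Nat.Partrec.Code.evaln_complete.1 hy
      exact ⟨k, Option.isSome_iff_exists.2 ⟨y, hk⟩⟩
    · rintro ⟨k, hk⟩
      obtain ⟨y, hy⟩ := Option.isSome_iff_exists.1 hk
      exact ⟨y, Nat.Partrec.Code.evaln_sound hy⟩

theorem rePred_of_rfindOpt {f : α → ℕ → Option β} (hf : Computable₂ f) :
    REPred fun a => ∃ n b, b ∈ f a n :=
  ((Partrec.rfindOpt hf).dom_re).of_eq fun _ => Nat.rfindOpt_dom

theorem rePred_of_primrecPred {p : α → Prop} (hp : PrimrecPred p) : REPred p :=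
  hp.computablePred.to_re

theorem rePred_comp {p : β → Prop} (hp : REPred p) {g : α → β} (hg : Computable g) :
    REPred fun a => p (g a) :=
  Partrec.comp hp hg

/-- A search for the witnesses of a recursively enumerable relation: one number codes a witness
and a halting time. -/
theorem exists_search {p : α × β → Prop} (hp : REPred p) :
    ∃ f : α → ℕ → Option β, Primrec₂ f ∧ (∀ a n b, b ∈ f a n → p (a, b)) ∧
      ∀ a b, p (a, b) → ∃ n, b ∈ f a n := by
  obtain ⟨f, hf, -, h⟩ := exists_primrec_of_rePred hp
  refine ⟨fun a n => (Encodable.decode (α := β) n.unpair.1).bind fun b =>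
    bif f ((a, b), n.unpair.2) then some b else none, ?_, ?_, ?_⟩
  · refine Primrec.option_bind (Primrec.decode.comp (Primrec.fst.comp
      (Primrec.unpair.comp Primrec.snd))) (Primrec.cond (hf.comp ?_)
        (Primrec.option_some.comp Primrec.snd) (Primrec.const none))
    exact ((Primrec.fst.comp Primrec.fst).pair Primrec.snd).pair
      (Primrec.snd.comp (Primrec.unpair.comp (Primrec.snd.comp Primrec.fst)))
  · intro a n b hb
    simp only [Option.mem_def, Option.bind_eq_some_iff] at hb
    obtain ⟨b', -, hb'⟩ := hb
    cases hfb : f ((a, b'), n.unpair.2) <;> simp [hfb] at hb'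
    subst hb'
    exact (h _).2 ⟨_, hfb⟩
  · intro a b hb
    obtain ⟨s, hs⟩ := (h _).1 hb
    exact ⟨Nat.pair (Encodable.encode b) s, by simp [hs]⟩

theorem rePred_exists {p : α × β → Prop} (hp : REPred p) : REPred fun a => ∃ b, p (a, b) := by
  obtain ⟨f, hf, h1, h2⟩ := exists_search hp
  refine (rePred_of_rfindOpt hf.to_comp).of_eq fun a => ⟨?_, ?_⟩
  · rintro ⟨n, b, hb⟩
    exact ⟨b, h1 a n b hb⟩
  · rintro ⟨b, hb⟩
    obtain ⟨n, hn⟩ := h2 a b hb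
    exact ⟨n, b, hn⟩

/-- Computable choice from a recursively enumerable total relation. -/
theorem exists_computable_choice {p : α × β → Prop} (hp : REPred p)
    (h : ∀ a, ∃ b, p (a, b)) : ∃ g : α → β, Computable g ∧ ∀ a, p (a, g a) := by
  obtain ⟨f, hf, h1, h2⟩ := exists_search hp
  have hdom : ∀ a, (Nat.rfindOpt (f a)).Dom := fun a => by
    obtain ⟨b, hb⟩ := h a
    obtain ⟨n, hn⟩ := h2 a b hb
    exact Nat.rfindOpt_dom.2 ⟨n, b, hn⟩
  refine ⟨fun a => (Nat.rfindOpt (f a)).get (hdom a),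
    (Partrec.rfindOpt hf.to_comp).of_eq_tot fun a => Part.get_mem _, fun a => ?_⟩
  obtain ⟨n, hn⟩ := Nat.rfindOpt_spec (Part.get_mem (hdom a))
  exact h1 a n _ hn

theorem rePred_or {p q : α → Prop} (hp : REPred p) (hq : REPred q) :
    REPred fun a => p a ∨ q a := by
  obtain ⟨f, hf, -, hf'⟩ := exists_primrec_of_rePred hp
  obtain ⟨g, hg, -, hg'⟩ := exists_primrec_of_rePred hq
  have : PrimrecPred fun x : α × ℕ => f x = true ∨ g x = true :=
    (Primrec.eq.comp hf (Primrec.const true)).or (Primrec.eq.comp hg (Primrec.const true))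
  refine (rePred_exists (rePred_of_primrecPred this)).of_eq fun a => ?_
  rw [hf', hg', exists_or]

/-- Acceptance is monotone in the halting time, so one time bound can serve both conditions. -/
theorem rePred_and {p q : α → Prop} (hp : REPred p) (hq : REPred q) :
    REPred fun a => p a ∧ q a := by
  obtain ⟨f, hf, hfm, hf'⟩ := exists_primrec_of_rePred hp
  obtain ⟨g, hg, hgm, hg'⟩ := exists_primrec_of_rePred hq
  have : PrimrecPred fun x : α × ℕ => f x = true ∧ g x = true :=
    (Primrec.eq.comp hf (Primrec.const true)).and (Primrec.eq.comp hg (Primrec.const true))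
  refine (rePred_exists (rePred_of_primrecPred this)).of_eq fun a => ?_
  rw [hf', hg']
  constructor
  · rintro ⟨s, h1, h2⟩
    exact ⟨⟨s, h1⟩, ⟨s, h2⟩⟩
  · rintro ⟨⟨s, h1⟩, ⟨t, h2⟩⟩
    exact ⟨max s t, hfm _ _ _ (le_max_left _ _) h1, hgm _ _ _ (le_max_right _ _) h2⟩

theorem rePred_forall_mem {p : β × α → Prop} (hp : REPred p) :
    REPred fun x : List β × α => ∀ b ∈ x.1, p (b, x.2) := by
  obtain ⟨f, hf, hfm, hf'⟩ := exists_primrec_of_rePred hp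
  have h1 : PrimrecRel fun (b : β) (y : α × ℕ) => f ((b, y.1), y.2) = true :=
    (Primrec.eq.comp (hf.comp ((Primrec.fst.pair (Primrec.fst.comp Primrec.snd)).pair
      (Primrec.snd.comp Primrec.snd))) (Primrec.const true)).primrecRel
  have h2 : PrimrecPred fun x : (List β × α) × ℕ => ∀ b ∈ x.1.1, f ((b, x.1.2), x.2) = true :=
    h1.forall_mem_list.comp (Primrec.fst.comp Primrec.fst)
      ((Primrec.snd.comp Primrec.fst).pair Primrec.snd)
  refine (rePred_exists (rePred_of_primrecPred h2)).of_eq fun x => ⟨?_, fun h => ?_⟩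
  · rintro ⟨s, hs⟩ b hb
    exact (hf' _).2 ⟨s, hs b hb⟩
  · exact forall_mem_exists_of_monotone (p := fun s b => f ((b, x.2), s) = true)
      (fun b s t hst => hfm _ s t hst) x.1 fun b hb => (hf' _).1 (h b hb)

end Enumerability

/-! ### Initial segments, intervals and sums over the strings of one length. -/

section InitialSegments

theorem initSeg_eq_ofFn (ω : BinSeq) (n : ℕ) : initSeg ω n = List.ofFn fun i : Fin n => ω i := by
  apply List.ext_getElem <;> simp [initSeg]

@[simp]
theorem length_initSeg (ω : BinSeq) (n : ℕ) : (initSeg ω n).length = n := by simp [initSeg]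

@[simp]
theorem initSeg_zero (ω : BinSeq) : initSeg ω 0 = [] := rfl

theorem initSeg_succ (ω : BinSeq) (n : ℕ) : initSeg ω (n + 1) = initSeg ω n ++ [ω n] := by
  simp [initSeg, List.range_succ]

theorem take_initSeg_eq_min (ω : BinSeq) (k n : ℕ) :
    (initSeg ω n).take k = initSeg ω (min k n) := by
  simp [initSeg, ← List.map_take, List.take_range]

theorem take_initSeg (ω : BinSeq) {m n : ℕ} (h : m ≤ n) :
    (initSeg ω n).take m = initSeg ω m := by
  rw [take_initSeg_eq_min, min_eq_left h]

theorem initSeg_prefix (ω : BinSeq) {m n : ℕ} (h : m ≤ n) : initSeg ω m <+: initSeg ω n := by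
  rw [← take_initSeg ω h]; exact List.take_prefix _ _

theorem mem_interval {ω : BinSeq} {x : List Bool} : ω ∈ interval x ↔ initSeg ω x.length = x :=
  Iff.rfl

theorem mem_interval_initSeg (ω : BinSeq) (n : ℕ) : ω ∈ interval (initSeg ω n) := by
  simp [mem_interval]

theorem interval_nonempty (x : List Bool) : (interval x).Nonempty := by
  refine ⟨fun i => x.getD i false, ?_⟩
  rw [mem_interval, initSeg_eq_ofFn]
  apply List.ext_getElem <;> simp

@[simp]
theorem interval_nil : interval [] = Set.univ := by
  ext ω; simp [mem_interval]

theorem interval_subset_of_prefix {x y : List Bool} (h : x <+: y) : interval y ⊆ interval x := by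
  intro ω hω
  rw [mem_interval] at *
  rw [← take_initSeg ω h.length_le, hω]
  exact (List.prefix_iff_eq_take.1 h).symm

theorem prefix_of_mem_interval {ω : BinSeq} {x y : List Bool} (hx : ω ∈ interval x)
    (hy : ω ∈ interval y) (h : x.length ≤ y.length) : x <+: y := by
  rw [mem_interval] at hx hy
  rw [← hx, ← hy]; exact initSeg_prefix ω h

theorem interval_split (x : List Bool) :
    interval x = interval (x ++ [false]) ∪ interval (x ++ [true]) := by
  ext ω
  simp only [Set.mem_union, mem_interval, List.length_append, List.length_cons, List.length_nil,
    zero_add, initSeg_succ]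
  cases h : ω x.length <;> simp

theorem interval_disjoint {x y : List Bool} (hl : x.length = y.length) (h : x ≠ y) :
    Disjoint (interval x) (interval y) := by
  rw [Set.disjoint_left]
  intro ω hx hy
  rw [mem_interval] at hx hy
  exact h (by rw [← hx, ← hy, hl])

theorem interval_split_disjoint (x : List Bool) :
    Disjoint (interval (x ++ [false])) (interval (x ++ [true])) :=
  interval_disjoint (by simp) (by simp)

theorem measurableSet_initSeg (n : ℕ) (q : List Bool → Prop) :
    MeasurableSet {ω : BinSeq | q (initSeg ω n)} := by
  have h : Measurable fun (ω : BinSeq) (i : Fin n) => ω i :=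
    measurable_pi_lambda _ fun i => measurable_pi_apply _
  simp only [initSeg_eq_ofFn]
  exact h (t := {f | q (List.ofFn f)}) (Set.toFinite _).measurableSet

theorem measurableSet_interval (x : List Bool) : MeasurableSet (interval x) :=
  measurableSet_initSeg x.length fun y => y = x

theorem isOpen_initSeg (n : ℕ) (q : List Bool → Prop) :
    IsOpen {ω : BinSeq | q (initSeg ω n)} := by
  have h : Continuous fun (ω : BinSeq) (i : Fin n) => ω i :=
    continuous_pi fun i => continuous_apply _
  simp only [initSeg_eq_ofFn]
  exact (isOpen_discrete {f : Fin n → Bool | q (List.ofFn f)}).preimage h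

/-- The list of all binary strings of length `n`. -/
def stringList : ℕ → List (List Bool)
  | 0 => [[]]
  | n + 1 => (stringList n).flatMap fun x => [x ++ [false], x ++ [true]]

theorem mem_stringList {n : ℕ} {x : List Bool} : x ∈ stringList n ↔ x.length = n := by
  induction n generalizing x with
  | zero => simp [stringList]
  | succ n ih =>
    simp only [stringList, List.mem_flatMap, ih, List.mem_cons, List.not_mem_nil, or_false]
    constructor
    · rintro ⟨y, rfl, rfl | rfl⟩ <;> simp
    · intro h
      have hx : x ≠ [] := by rintro rfl; simp at h
      refine ⟨x.dropLast, by simp [h], ?_⟩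
      have := List.dropLast_append_getLast hx
      cases hb : x.getLast hx <;> rw [hb] at this <;> simp [this]

theorem primrec_stringList : Primrec stringList := by
  have h : Primrec₂ fun (_ : ℕ) (L : List (List Bool)) =>
      L.flatMap fun x => [x ++ [false], x ++ [true]] := by
    refine Primrec.list_flatMap Primrec.snd ?_
    refine Primrec.list_cons.comp (Primrec.list_append.comp Primrec.snd (Primrec.const _)) ?_
    exact Primrec.list_cons.comp (Primrec.list_append.comp Primrec.snd (Primrec.const _))
      (Primrec.const _)
  refine (Primrec.nat_rec₁ [[]] h).of_eq fun n => ?_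
  induction n with
  | zero => rfl
  | succ n ih => simp only [stringList, ← ih]

/-- The finite set of all binary strings of length `n`. -/
def strings (n : ℕ) : Finset (List Bool) := (stringList n).toFinset

@[simp]
theorem mem_strings {n : ℕ} {x : List Bool} : x ∈ strings n ↔ x.length = n := by
  simp [strings, mem_stringList]

theorem sum_strings_succ {A : Type*} [AddCommMonoid A] (g : List Bool → A) (n : ℕ) :
    ∑ x ∈ strings (n + 1), g x = ∑ x ∈ strings n, (g (x ++ [false]) + g (x ++ [true])) := by
  have h : strings (n + 1) =
      (strings n ×ˢ (Finset.univ : Finset Bool)).image fun p => p.1 ++ [p.2] := by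
    ext x
    simp only [strings, stringList, List.mem_toFinset, List.mem_flatMap, List.mem_cons,
      List.not_mem_nil, or_false, Finset.mem_image, Finset.mem_product, Finset.mem_univ, and_true,
      Prod.exists, Bool.exists_bool]
    grind
  rw [h, Finset.sum_image, Finset.sum_product]
  · refine Finset.sum_congr rfl fun x _ => ?_
    rw [Fintype.sum_bool, add_comm]
  · rintro ⟨x, a⟩ - ⟨y, b⟩ - hxy
    simpa using List.append_inj' hxy rfl

theorem tsum_strings (n : ℕ) (c : List Bool → Prop) [DecidablePred c] (g : List Bool → ℝ≥0∞) :
    (∑' x, if x.length = n ∧ c x then g x else 0) = ∑ x ∈ strings n with c x, g x := by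
  classical
  rw [tsum_eq_sum (s := strings n), Finset.sum_filter]
  · refine Finset.sum_congr rfl fun x hx => ?_
    simp [mem_strings.1 hx]
  · intro x hx
    simp only [mem_strings] at hx
    simp [hx]

theorem antitone_sum_strings {n : ℕ} {g : List Bool → ℝ≥0∞}
    (h : ∀ x, n ≤ x.length → g (x ++ [false]) + g (x ++ [true]) ≤ g x) {m : ℕ} (hm : n ≤ m) :
    ∑ x ∈ strings m, g x ≤ ∑ x ∈ strings n, g x := by
  induction m, hm using Nat.le_induction with
  | base => exact le_rfl
  | succ m hm ih =>
    rw [sum_strings_succ]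
    exact (Finset.sum_le_sum fun x hx => h x (by rwa [mem_strings.1 hx])).trans ih

theorem setOf_initSeg_eq_biUnion (n : ℕ) (q : List Bool → Prop) [DecidablePred q] :
    {ω : BinSeq | q (initSeg ω n)} = ⋃ x ∈ (strings n).filter q, interval x := by
  ext ω
  simp only [Set.mem_ofPred_eq, Finset.mem_filter, mem_strings, Set.mem_iUnion, exists_prop]
  constructor
  · intro h
    exact ⟨_, ⟨length_initSeg ω n, h⟩, mem_interval_initSeg ω n⟩
  · rintro ⟨x, ⟨rfl, hx⟩, hω⟩
    rwa [mem_interval.1 hω]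

theorem measure_initSeg_eq_sum (μ : Measure BinSeq) (n : ℕ) (q : List Bool → Prop)
    [DecidablePred q] :
    μ {ω | q (initSeg ω n)} = ∑ x ∈ strings n with q x, μ (interval x) := by
  rw [setOf_initSeg_eq_biUnion,
    measure_biUnion_finset _ fun x _ => measurableSet_interval x]
  intro x hx y hy hxy
  simp only [Finset.coe_filter, mem_strings, Set.mem_ofPred_eq] at hx hy
  exact interval_disjoint (hx.1.trans hy.1.symm) hxy

end InitialSegments

theorem primrec_two_pow : Primrec fun n : ℕ => 2 ^ n :=
  (Primrec.nat_rec₁ (f := fun _ m => 2 * m) 1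
    (Primrec.nat_double.comp Primrec.snd)).of_eq fun n => by
    induction n with
    | zero => rfl
    | succ n ih => rw [pow_succ, mul_comm, ← ih]

/-! ### Enumerability with the parameter as an oracle, and compactness. -/

section OracleEnumerability

variable {α β : Type*} [Primcodable α] [Primcodable β]

/-- Recursive enumerability relative to the parameter as an oracle. -/
def ParamRE (A : BinSeq → α → Prop) : Prop :=
  ∃ W : List Bool × α → Prop, REPred W ∧ ∀ θ a, A θ a ↔ ∃ n, W (initSeg θ n, a)

theorem ParamRE.of_iff {A B : BinSeq → α → Prop} (hA : ParamRE A) (h : ∀ θ a, A θ a ↔ B θ a) :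
    ParamRE B := by
  obtain ⟨W, hW, hWA⟩ := hA
  exact ⟨W, hW, fun θ a => (h θ a).symm.trans (hWA θ a)⟩

/-- The enumeration may be chosen to be closed under extension of the oracle string. -/
theorem ParamRE.exists_monotone {A : BinSeq → α → Prop} (hA : ParamRE A) :
    ∃ W : List Bool × α → Prop, REPred W ∧
      (∀ θ a m n, m ≤ n → W (initSeg θ m, a) → W (initSeg θ n, a)) ∧
      ∀ θ a, A θ a ↔ ∃ n, W (initSeg θ n, a) := by
  obtain ⟨W, hW, h⟩ := hA
  -- An oracle string is accepted as soon as one of its truncations is.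
  refine ⟨fun x => ∃ m : ℕ, W (x.1.take m, x.2), ?_, ?_, ?_⟩
  · exact rePred_exists (p := fun y : (List Bool × α) × ℕ => W (y.1.1.take y.2, y.1.2))
      (rePred_comp hW (Primrec.to_comp ((Primrec.list_take.comp Primrec.snd
        (Primrec.fst.comp Primrec.fst)).pair (Primrec.snd.comp Primrec.fst))))
  · rintro θ a m n hmn ⟨k, hk⟩
    refine ⟨min k m, ?_⟩
    simp only [take_initSeg_eq_min] at hk ⊢
    rwa [min_eq_left ((min_le_right k m).trans hmn)]
  · intro θ a
    rw [h]
    constructor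
    · rintro ⟨n, hn⟩
      exact ⟨n, n, by rwa [take_initSeg θ le_rfl]⟩
    · rintro ⟨n, m, hm⟩
      exact ⟨min m n, by rwa [← take_initSeg_eq_min]⟩

theorem paramRE_const {p : α → Prop} (hp : REPred p) : ParamRE fun _ a => p a :=
  ⟨fun x => p x.2, rePred_comp hp Computable.snd, by simp⟩

theorem ParamRE.comp {A : BinSeq → β → Prop} (hA : ParamRE A) {g : α → β} (hg : Computable g) :
    ParamRE fun θ a => A θ (g a) := by
  obtain ⟨W, hW, h⟩ := hA
  exact ⟨fun x => W (x.1, g x.2),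
    rePred_comp hW (Computable.fst.pair (hg.comp Computable.snd)), fun θ a => h θ (g a)⟩

theorem ParamRE.exists {A : BinSeq → α × β → Prop} (hA : ParamRE A) :
    ParamRE fun θ a => ∃ b, A θ (a, b) := by
  obtain ⟨W, hW, h⟩ := hA
  refine ⟨fun x => ∃ b, W (x.1, x.2, b), rePred_exists
    (p := fun y : (List Bool × α) × β => W (y.1.1, y.1.2, y.2)) (rePred_comp hW ?_), ?_⟩
  · exact Primrec.to_comp ((Primrec.fst.comp Primrec.fst).pair
      ((Primrec.snd.comp Primrec.fst).pair Primrec.snd))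
  · intro θ a
    simp only [h]
    exact exists_comm

theorem ParamRE.or {A B : BinSeq → α → Prop} (hA : ParamRE A) (hB : ParamRE B) :
    ParamRE fun θ a => A θ a ∨ B θ a := by
  obtain ⟨V, hV, h⟩ := hA
  obtain ⟨W, hW, h'⟩ := hB
  exact ⟨_, rePred_or hV hW, fun θ a => by simp only [h, h', exists_or]⟩

theorem ParamRE.and {A B : BinSeq → α → Prop} (hA : ParamRE A) (hB : ParamRE B) :
    ParamRE fun θ a => A θ a ∧ B θ a := by
  obtain ⟨V, hV, hVm, h⟩ := hA.exists_monotone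
  obtain ⟨W, hW, hWm, h'⟩ := hB.exists_monotone
  refine ⟨_, rePred_and hV hW, fun θ a => ?_⟩
  simp only [h, h']
  constructor
  · rintro ⟨⟨m, hm⟩, ⟨n, hn⟩⟩
    exact ⟨max m n, hVm θ a _ _ (le_max_left _ _) hm, hWm θ a _ _ (le_max_right _ _) hn⟩
  · rintro ⟨n, h1, h2⟩
    exact ⟨⟨n, h1⟩, ⟨n, h2⟩⟩

theorem ParamRE.forall_mem {A : BinSeq → β × α → Prop} (hA : ParamRE A) :
    ParamRE fun θ (x : List β × α) => ∀ b ∈ x.1, A θ (b, x.2) := by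
  obtain ⟨W, hW, hWm, h⟩ := hA.exists_monotone
  refine ⟨fun x => ∀ b ∈ x.2.1, W (x.1, b, x.2.2), ?_, fun θ x => ⟨fun hx => ?_, ?_⟩⟩
  · have h1 : REPred fun y : β × (List Bool × α) => W (y.2.1, y.1, y.2.2) :=
      rePred_comp hW (Primrec.to_comp ((Primrec.fst.comp Primrec.snd).pair
        (Primrec.fst.pair (Primrec.snd.comp Primrec.snd))))
    exact rePred_comp (rePred_forall_mem h1) (Primrec.to_comp ((Primrec.fst.comp Primrec.snd).pair
      (Primrec.fst.pair (Primrec.snd.comp Primrec.snd)))) (g := fun x : List Bool × List β × α =>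
        (x.2.1, x.1, x.2.2))
  · exact forall_mem_exists_of_monotone (p := fun n b => W (initSeg θ n, b, x.2))
      (fun b s t => hWm θ _ s t) x.1 fun b hb => (h θ _).1 (hx b hb)
  · rintro ⟨n, hn⟩ b hb
    exact (h θ _).2 ⟨n, hn b hb⟩

theorem paramRE_mem_interval : ParamRE fun θ (σ : List Bool) => θ ∈ interval σ := by
  refine ⟨fun x => x.1 = x.2, rePred_of_primrecPred (Primrec.eq.comp Primrec.fst Primrec.snd),
    fun θ σ => ⟨fun h => ⟨_, h⟩, ?_⟩⟩
  rintro ⟨n, h⟩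
  exact (show initSeg θ n = σ from h) ▸ mem_interval_initSeg θ n

theorem computable_initSeg {θ : BinSeq} (hθ : Computable θ) : Computable (initSeg θ) := by
  refine (Computable.nat_rec (f := fun n : ℕ => n) (g := fun _ => ([] : List Bool))
    (h := fun _ p => p.2 ++ [θ p.1]) Computable.id (Computable.const _) ?_).of_eq fun n => ?_
  · exact Computable.list_concat.comp (Computable.snd.comp Computable.snd)
      (hθ.comp (Computable.fst.comp Computable.snd))
  · induction n with
    | zero => rfl
    | succ n ih => rw [initSeg_succ, ← ih]

theorem ParamRE.rePred {A : BinSeq → α → Prop} (hA : ParamRE A) {θ : BinSeq}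
    (hθ : Computable θ) : REPred (A θ) := by
  obtain ⟨W, hW, h⟩ := hA
  have h1 : REPred fun x : α × ℕ => W (initSeg θ x.2, x.1) :=
    rePred_comp hW (((computable_initSeg hθ).comp Computable.snd).pair Computable.fst)
  exact (rePred_exists h1).of_eq fun a => (h θ a).symm

/-- By compactness of the parameter space, a property of all parameters that is enumerable with
an oracle is enumerable. -/
theorem ParamRE.rePred_forall {A : BinSeq → α → Prop} (hA : ParamRE A) :
    REPred fun a => ∀ θ, A θ a := by
  obtain ⟨W, hW, hWm, h⟩ := hA.exists_monotone
  have h1 : REPred fun y : List Bool × (α × ℕ) => W (y.1, y.2.1) :=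
    rePred_comp hW (Primrec.to_comp (Primrec.fst.pair (Primrec.fst.comp Primrec.snd)))
  have h2 : REPred fun y : α × ℕ => ∀ σ ∈ stringList y.2, W (σ, y.1) :=
    rePred_comp (rePred_forall_mem h1) (g := fun y : α × ℕ => (stringList y.2, y))
      (Primrec.to_comp ((primrec_stringList.comp Primrec.snd).pair Primrec.id))
  refine (rePred_exists h2).of_eq fun a => ⟨?_, fun ha => ?_⟩
  · rintro ⟨n, hn⟩ θ
    exact (h θ a).2 ⟨n, hn _ (mem_stringList.2 (length_initSeg θ n))⟩
  -- The parameters accepted at level `n` form open sets increasing with `n`, so one level accepts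
  -- all of them. It then suffices to check the finitely many strings of that length.
  · obtain ⟨n, hn⟩ := isCompact_univ.elim_directed_cover
      (fun n => {θ : BinSeq | W (initSeg θ n, a)})
      (fun n => isOpen_initSeg n fun σ => W (σ, a))
      (fun θ _ => Set.mem_iUnion.2 ((h θ a).1 (ha θ)))
      (Monotone.directed_le fun m n hmn θ hθ => hWm θ a m n hmn hθ)
    refine ⟨n, fun σ hσ => ?_⟩
    obtain ⟨θ, hθ⟩ := interval_nonempty σ
    have := hn (Set.mem_univ θ)
    rw [mem_stringList] at hσ
    rw [mem_interval, hσ] at hθ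
    rwa [← hθ]

end OracleEnumerability

/-! ### Lower semicomputable functions with values in `[0, ∞]`. -/

section LowerApproximation

/-- The nonnegative rational number with the name `(u, v)`. -/
def frac (p : ℕ × ℕ) : ℝ≥0∞ := (p.1 : ℝ≥0∞) / ((p.2 : ℝ≥0∞) + 1)

theorem frac_eq_ofReal (p : ℕ × ℕ) : frac p = ENNReal.ofReal ((p.1 : ℝ) / ((p.2 : ℝ) + 1)) := by
  rw [frac, ENNReal.ofReal_div_of_pos (by positivity), ENNReal.ofReal_natCast,
    ENNReal.ofReal_add (by positivity) zero_le_one, ENNReal.ofReal_natCast, ENNReal.ofReal_one]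

theorem frac_lt_iff {p : ℕ × ℕ} {x : ℝ≥0∞} (hx : x ≠ ∞) :
    frac p < x ↔ (p.1 : ℝ) / ((p.2 : ℝ) + 1) < x.toReal := by
  rw [frac_eq_ofReal, ENNReal.ofReal_lt_iff_lt_toReal (by positivity) hx]

theorem frac_lt_coe_iff {p : ℕ × ℕ} {x : ℝ≥0} :
    frac p < (x : ℝ≥0∞) ↔ (p.1 : ℝ) / ((p.2 : ℝ) + 1) < x := by
  rw [frac_lt_iff ENNReal.coe_ne_top, ENNReal.coe_toReal]

theorem frac_lt_frac {p q : ℕ × ℕ} : frac p < frac q ↔ p.1 * (q.2 + 1) < q.1 * (p.2 + 1) := by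
  rw [frac_eq_ofReal, frac_eq_ofReal, ENNReal.ofReal_lt_ofReal_iff_of_nonneg (by positivity),
    div_lt_div_iff₀ (by positivity) (by positivity)]
  exact_mod_cast Iff.rfl

theorem exists_frac_btwn {x y : ℝ≥0∞} (h : x < y) : ∃ p, x < frac p ∧ frac p < y := by
  obtain ⟨q, hq, h1, h2⟩ := ENNReal.lt_iff_exists_rat_btwn.1 h
  refine ⟨(q.num.toNat, q.den - 1), ?_⟩
  have h3 : frac (q.num.toNat, q.den - 1) = ENNReal.ofReal q := by
    rw [frac_eq_ofReal]
    have hd : ((q.den - 1 : ℕ) : ℝ) + 1 = q.den := by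
      rw [Nat.cast_sub q.pos]; simp
    have hn : ((q.num.toNat : ℕ) : ℝ) = q.num := by
      exact_mod_cast Int.toNat_of_nonneg (Rat.num_nonneg.2 hq)
    simp only [hd, hn]
    congr 1
    exact_mod_cast (Rat.num_div_den q)
  rw [h3]
  exact ⟨h1, h2⟩

theorem list_sum_eq_sum_range_getD (L : List ℕ) :
    L.sum = ∑ i ∈ Finset.range L.length, L.getD i 0 := by
  induction L with
  | nil => simp
  | cons a L ih => simp [Finset.sum_range_succ', ih, add_comm]

/-- A lower bound of a series of nonnegative terms is certified by finitely many lower bounds,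
with a common denominator, of its terms. -/
theorem frac_lt_tsum_iff {h : ℕ → ℝ≥0∞} (hfin : ∀ i, h i ≠ ∞) (p : ℕ × ℕ) :
    frac p < ∑' i, h i ↔ ∃ D : ℕ, ∃ L : List ℕ,
      (∀ i ∈ List.range L.length, L.getD i 0 = 0 ∨ frac (L.getD i 0, D) < h i) ∧
        p.1 * (D + 1) < L.sum * (p.2 + 1) := by
  constructor
  · intro hp
    rw [ENNReal.tsum_eq_iSup_nat, lt_iSup_iff] at hp
    obtain ⟨N, hN⟩ := hp
    rw [frac_lt_iff (ENNReal.sum_ne_top.2 fun i _ => hfin i),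
      ENNReal.toReal_sum fun i _ => hfin i] at hN
    set r : ℝ := (p.1 : ℝ) / ((p.2 : ℝ) + 1) with hr
    set S : ℝ := ∑ i ∈ Finset.range N, (h i).toReal with hS
    -- Rounding each of the `N` terms down to denominator `D + 1` costs at most `N / (D + 1)`, which
    -- must stay below the slack `S - r`.
    obtain ⟨D, hD⟩ := exists_nat_one_div_lt (show 0 < (S - r) / ((N : ℝ) + 1) by
      have : 0 < S - r := by linarith
      positivity)
    have hD0 : (0 : ℝ) < (D : ℝ) + 1 := by positivity
    -- The ceiling minus one keeps the bound strict. A zero numerator needs its own alternative,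
    -- since `0 < h i` may fail.
    set c : ℕ → ℕ := fun i => ⌈(h i).toReal * ((D : ℝ) + 1)⌉₊ - 1 with hc
    have hlen : ((List.range N).map c).length = N := by simp
    have hget : ∀ i < N, ((List.range N).map c).getD i 0 = c i := by
      intro i hi; simp [hi]
    refine ⟨D, (List.range N).map c, fun i hi => ?_, ?_⟩
    · rw [hlen, List.mem_range] at hi
      rw [hget i hi, frac_lt_iff (hfin i)]
      rcases Nat.eq_zero_or_pos (c i) with h0 | h0
      · exact Or.inl h0
      · right
        rw [div_lt_iff₀ hD0]
        exact Nat.lt_ceil.1 (show c i < ⌈(h i).toReal * ((D : ℝ) + 1)⌉₊ by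
          simp only [hc] at h0 ⊢; omega)
    · rw [list_sum_eq_sum_range_getD, hlen, Finset.sum_congr rfl fun i hi =>
        hget i (Finset.mem_range.1 hi)]
      have h1 : S * ((D : ℝ) + 1) ≤ (∑ i ∈ Finset.range N, c i : ℕ) + N := by
        rw [hS, Finset.sum_mul]
        push_cast
        calc _ ≤ ∑ i ∈ Finset.range N, ((c i : ℝ) + 1) := by
              refine Finset.sum_le_sum fun i _ => (Nat.le_ceil _).trans ?_
              exact_mod_cast (by simp only [hc]; omega :
                ⌈(h i).toReal * ((D : ℝ) + 1)⌉₊ ≤ c i + 1)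
          _ = _ := by simp [Finset.sum_add_distrib]
      have h2 : (N : ℝ) < (S - r) * ((D : ℝ) + 1) := by
        rw [div_lt_div_iff₀ hD0 (by positivity)] at hD
        linarith
      have h3 : r * ((D : ℝ) + 1) < (∑ i ∈ Finset.range N, c i : ℕ) := by linarith
      rw [hr, div_mul_eq_mul_div, div_lt_iff₀ (by positivity)] at h3
      exact_mod_cast h3
  · rintro ⟨D, L, hL, hs⟩
    calc frac p < frac (L.sum, D) := frac_lt_frac.2 hs
      _ = ∑ i ∈ Finset.range L.length, frac (L.getD i 0, D) := by
          rw [list_sum_eq_sum_range_getD]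
          simp only [frac, div_eq_mul_inv, Nat.cast_sum, Finset.sum_mul]
      _ ≤ ∑ i ∈ Finset.range L.length, h i := by
          refine Finset.sum_le_sum fun i hi => ?_
          rcases hL i (List.mem_range.2 (Finset.mem_range.1 hi)) with h0 | h0
          · rw [h0]; simp [frac]
          · exact h0.le
      _ ≤ ∑' i, h i := ENNReal.sum_le_tsum _

variable {α β : Type*} [Primcodable α] [Primcodable β]

/-- Semicomputability from below, with the parameter as an oracle. -/
def ParamLSC (f : BinSeq → α → ℝ≥0∞) : Prop :=
  ParamRE fun θ (p : (ℕ × ℕ) × α) => frac p.1 < f θ p.2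

theorem ParamLSC.comp {f : BinSeq → β → ℝ≥0∞} (hf : ParamLSC f) {g : α → β}
    (hg : Computable g) : ParamLSC fun θ a => f θ (g a) :=
  ParamRE.comp hf (Computable.fst.pair (hg.comp Computable.snd))

open Classical in
theorem ParamLSC.ite {f : BinSeq → α → ℝ≥0∞} (hf : ParamLSC f) {A : BinSeq → α → Prop}
    (hA : ParamRE A) : ParamLSC fun θ a => if A θ a then f θ a else 0 := by
  refine ((hA.comp Computable.snd).and hf).of_iff fun θ p => ?_
  by_cases h : A θ p.2 <;> simp [h]

theorem ParamLSC.iSup {f : BinSeq → α × β → ℝ≥0∞} (hf : ParamLSC f) :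
    ParamLSC fun θ a => ⨆ b, f θ (a, b) := by
  have h : ParamRE fun θ (q : ((ℕ × ℕ) × α) × β) => frac q.1.1 < f θ (q.1.2, q.2) :=
    ParamRE.comp hf (g := fun q : ((ℕ × ℕ) × α) × β => (q.1.1, q.1.2, q.2)) (Primrec.to_comp
      ((Primrec.fst.comp Primrec.fst).pair ((Primrec.snd.comp Primrec.fst).pair Primrec.snd)))
  exact h.exists.of_iff fun θ p => by simp only [lt_iSup_iff]

/-- The power of two moves into the denominator of the rational bound. As `frac` adds one to its
second argument, the new name subtracts one. -/
theorem ParamLSC.two_pow_mul {f : BinSeq → α → ℝ≥0∞} (hf : ParamLSC f) {g : α → ℕ}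
    (hg : Primrec g) : ParamLSC fun θ a => 2 ^ g a * f θ a := by
  refine (ParamRE.comp hf (g := fun p : (ℕ × ℕ) × α =>
    ((p.1.1, (p.1.2 + 1) * 2 ^ g p.2 - 1), p.2)) (Primrec.to_comp ?_)).of_iff fun θ p => ?_
  · refine ((Primrec.fst.comp Primrec.fst).pair (Primrec.nat_sub.comp (Primrec.nat_mul.comp
      (Primrec.succ.comp (Primrec.snd.comp Primrec.fst))
      (primrec_two_pow.comp (hg.comp Primrec.snd))) (Primrec.const 1))).pair Primrec.snd
  · have h1 : (((p.1.2 + 1) * 2 ^ g p.2 - 1 : ℕ) : ℝ≥0∞) + 1 =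
        ((p.1.2 : ℝ≥0∞) + 1) * 2 ^ g p.2 := by
      have : 1 ≤ (p.1.2 + 1) * 2 ^ g p.2 := Nat.one_le_iff_ne_zero.2 (by positivity)
      have h2 : ((p.1.2 + 1) * 2 ^ g p.2 - 1) + 1 = (p.1.2 + 1) * 2 ^ g p.2 := by omega
      exact_mod_cast congrArg (Nat.cast (R := ℝ≥0∞)) h2
    simp only [frac, h1]
    rw [ENNReal.div_lt_iff (by simp) (by simp [ENNReal.mul_eq_top]),
      ENNReal.div_lt_iff (by simp) (by simp)]
    ring_nf

theorem primrec_list_sum : Primrec (List.sum : List ℕ → ℕ) :=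
  (Primrec.list_foldr (f := fun L : List ℕ => L) (g := fun _ => 0) (h := fun _ p => p.1 + p.2)
    Primrec.id (Primrec.const 0) (Primrec.nat_add.comp (Primrec.fst.comp Primrec.snd)
      (Primrec.snd.comp Primrec.snd))).of_eq fun L => by
    induction L with
    | nil => rfl
    | cons a L ih => simp [← ih]

/-- The series is reindexed by the codes of `β`, with zero at numbers that code nothing. The finite
certificates of `frac_lt_tsum_iff` then involve only bounded quantifiers and can be searched for. -/
theorem ParamLSC.tsum {f : BinSeq → α × β → ℝ≥0∞} (hf : ParamLSC f)
    (hfin : ∀ θ x, f θ x ≠ ∞) : ParamLSC fun θ a => ∑' b, f θ (a, b) := by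
  have key : ∀ θ (p : (ℕ × ℕ) × α), (frac p.1 < ∑' b, f θ (p.2, b)) ↔ ∃ x : ℕ × List ℕ,
      (∀ i ∈ List.range x.2.length, x.2.getD i 0 = 0 ∨
        ∃ b : β, Encodable.encode b = i ∧ frac (x.2.getD i 0, x.1) < f θ (p.2, b)) ∧
        p.1.1 * (x.1 + 1) < x.2.sum * (p.1.2 + 1) := by
    intro θ p
    have hinj : Function.Injective (Encodable.encode : β → ℕ) := Encodable.encode_injective
    rw [← tsum_extend_zero hinj fun b => f θ (p.2, b), frac_lt_tsum_iff, Prod.exists]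
    · refine exists_congr fun D => exists_congr fun L => and_congr_left' <|
        forall₂_congr fun i _ => or_congr_right ?_
      constructor
      · intro h
        by_cases hi : ∃ b : β, Encodable.encode b = i
        · obtain ⟨b, rfl⟩ := hi
          rw [hinj.extend_apply] at h
          exact ⟨b, rfl, h⟩
        · rw [Function.extend_apply' _ _ _ hi] at h
          simp at h
      · rintro ⟨b, rfl, h⟩
        rwa [hinj.extend_apply]
    · intro i
      by_cases hi : ∃ b : β, Encodable.encode b = i
      · obtain ⟨b, rfl⟩ := hi
        rw [hinj.extend_apply]
        exact hfin _ _
      · rw [Function.extend_apply' _ _ _ hi]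
        simp
  let X := ((ℕ × ℕ) × α) × (ℕ × List ℕ)
  have hget : Primrec fun y : ℕ × X => y.2.2.2.getD y.1 0 :=
    (Primrec.list_getD 0).comp (Primrec.snd.comp (Primrec.snd.comp Primrec.snd)) Primrec.fst
  have h1 : ParamRE fun _ (y : ℕ × X) => y.2.2.2.getD y.1 0 = 0 :=
    paramRE_const (rePred_of_primrecPred (Primrec.eq.comp hget (Primrec.const 0)))
  have h2 : ParamRE fun θ (y : (ℕ × X) × β) => Encodable.encode y.2 = y.1.1 ∧
      frac (y.1.2.2.2.getD y.1.1 0, y.1.2.2.1) < f θ (y.1.2.1.2, y.2) := by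
    refine (paramRE_const (rePred_of_primrecPred (Primrec.eq.comp
      (Primrec.encode.comp Primrec.snd) (Primrec.fst.comp Primrec.fst)))).and ?_
    refine ParamRE.comp hf (g := fun y : (ℕ × X) × β =>
      ((y.1.2.2.2.getD y.1.1 0, y.1.2.2.1), (y.1.2.1.2, y.2))) (Primrec.to_comp ?_)
    refine ((hget.comp Primrec.fst).pair (Primrec.fst.comp (Primrec.snd.comp
      (Primrec.snd.comp Primrec.fst)))).pair (Primrec.pair ?_ Primrec.snd)
    exact Primrec.snd.comp (Primrec.fst.comp (Primrec.snd.comp Primrec.fst))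
  have h3 : ParamRE fun θ (y : X) => ∀ i ∈ List.range y.2.2.length, y.2.2.getD i 0 = 0 ∨
      ∃ b : β, Encodable.encode b = i ∧ frac (y.2.2.getD i 0, y.2.1) < f θ (y.1.2, b) :=
    (h1.or h2.exists).forall_mem.comp (g := fun y : X => (List.range y.2.2.length, y))
      (Primrec.to_comp ((Primrec.list_range.comp (Primrec.list_length.comp
        (Primrec.snd.comp Primrec.snd))).pair Primrec.id))
  have h4 : ParamRE fun _ (y : X) => y.1.1.1 * (y.2.1 + 1) < y.2.2.sum * (y.1.1.2 + 1) := by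
    refine paramRE_const (rePred_of_primrecPred (Primrec.nat_lt.comp
      (Primrec.nat_mul.comp ?_ (Primrec.succ.comp ?_))
      (Primrec.nat_mul.comp (primrec_list_sum.comp ?_) (Primrec.succ.comp ?_))))
    · exact Primrec.fst.comp (Primrec.fst.comp Primrec.fst)
    · exact Primrec.fst.comp Primrec.snd
    · exact Primrec.snd.comp Primrec.snd
    · exact Primrec.snd.comp (Primrec.fst.comp Primrec.fst)
  exact (h3.and h4).exists.of_iff fun θ p => (key θ p).symm

end LowerApproximation

/-! ### The greatest measure below a semimeasure. -/

section MaximalMeasure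

open Classical in
/-- The mass, with respect to `P`, of the strings of length `n` whose intervals meet `t`. -/
def levelMass (P : List Bool → ℝ≥0) (n : ℕ) (t : Set BinSeq) : ℝ≥0∞ :=
  ∑ x ∈ strings n, if (interval x ∩ t).Nonempty then (P x : ℝ≥0∞) else 0

variable {P : List Bool → ℝ≥0}

theorem IsSemimeasure.split_le_coe (hP : IsSemimeasure P) (x : List Bool) :
    (P (x ++ [false]) : ℝ≥0∞) + P (x ++ [true]) ≤ P x := by
  exact_mod_cast hP.split_le x

theorem antitone_levelMass (hP : IsSemimeasure P) (t : Set BinSeq) :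
    Antitone fun n => levelMass P n t := by
  classical
  intro n m hnm
  refine antitone_sum_strings (fun x _ => ?_) hnm
  by_cases h : (interval x ∩ t).Nonempty
  · rw [if_pos h]
    refine le_trans (add_le_add ?_ ?_) (hP.split_le_coe x) <;> split_ifs <;> simp
  · have h' : ∀ b, ¬ (interval (x ++ [b]) ∩ t).Nonempty := fun b hb =>
      h (hb.mono (Set.inter_subset_inter_left t
        (interval_subset_of_prefix (List.prefix_append x [b]))))
    simp [h, h']

/-- From level `y.length` on, an interval lies inside `interval y` or is disjoint from it, so each
string is charged to at most one side. -/
theorem levelMass_split {y : List Bool} {n : ℕ} (hy : y.length ≤ n) (t : Set BinSeq) :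
    levelMass P n (t ∩ interval y) + levelMass P n (t \ interval y) ≤ levelMass P n t := by
  classical
  rw [levelMass, levelMass, ← Finset.sum_add_distrib]
  refine Finset.sum_le_sum fun x hx => ?_
  rw [mem_strings] at hx
  by_cases hyx : y <+: x
  · have h1 : ¬ (interval x ∩ (t \ interval y)).Nonempty := by
      rintro ⟨ω, h1, -, h2⟩
      exact h2 (interval_subset_of_prefix hyx h1)
    rw [if_neg h1, add_zero]
    split_ifs with h2 h3 <;> try simp
    exact absurd (h2.mono (by gcongr; exact Set.inter_subset_left)) h3
  · have h1 : ¬ (interval x ∩ (t ∩ interval y)).Nonempty := by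
      rintro ⟨ω, h1, -, h2⟩
      exact hyx (prefix_of_mem_interval h2 h1 (by omega))
    rw [if_neg h1, zero_add]
    split_ifs with h2 h3 <;> try simp
    exact absurd (h2.mono (by gcongr; exact Set.sdiff_subset)) h3

theorem pi_le_of_measurableSet_interval {m : MeasurableSpace BinSeq}
    (h : ∀ x, MeasurableSet[m] (interval x)) : MeasurableSpace.pi ≤ m := by
  classical
  refine iSup_le fun i => ?_
  rintro s ⟨u, -, rfl⟩
  have h1 : (fun ω : BinSeq => ω i) ⁻¹' u =
      {ω | (initSeg ω (i + 1)).getD i false ∈ u} := by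
    ext ω; simp [initSeg]
  rw [h1, setOf_initSeg_eq_biUnion (i + 1) fun x => x.getD i false ∈ u]
  exact Finset.measurableSet_biUnion _ fun x _ => h x

theorem iInf_levelMass_empty : ⨅ n, levelMass P n ∅ = 0 := by
  refine le_antisymm ((iInf_le _ 0).trans ?_) zero_le
  simp [levelMass]

/-- The outer measure of covers by closed sets; it is additive on the Borel sets. -/
def closedCoverMeasure (P : List Bool → ℝ≥0) : OuterMeasure BinSeq :=
  OuterMeasure.ofFunction (fun t => ⨅ n, levelMass P n t) iInf_levelMass_empty

/-- It suffices to split the covering function along each interval `y`. Since level masses decrease,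
one may pass to a level of at least `y.length`, where the splitting is available. -/
theorem pi_le_caratheodory (hP : IsSemimeasure P) :
    MeasurableSpace.pi ≤ (closedCoverMeasure P).caratheodory := by
  refine pi_le_of_measurableSet_interval fun y => OuterMeasure.ofFunction_caratheodory fun t => ?_
  refine le_iInf fun n => ?_
  calc _ ≤ levelMass P (max n y.length) (t ∩ interval y) +
        levelMass P (max n y.length) (t \ interval y) :=
        add_le_add (iInf_le (fun n => levelMass P n (t ∩ interval y)) _)
          (iInf_le (fun n => levelMass P n (t \ interval y)) _)
    _ ≤ levelMass P (max n y.length) t := levelMass_split (le_max_right _ _) t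
    _ ≤ levelMass P n t := antitone_levelMass hP t (le_max_left _ _)

/-- The maximal measure below a semimeasure is below the semimeasure. -/
theorem bar_interval_le (hP : IsSemimeasure P) (y : List Bool) :
    bar P (interval y) ≤ P y := by
  classical
  -- A supremum of measures is not taken pointwise, so it is bounded by a single measure that
  -- dominates every admissible `μ` and is itself at most `P y` on `interval y`.
  have h1 : bar P ≤ (closedCoverMeasure P).toMeasure (pi_le_caratheodory hP) := by
    refine sSup_le fun μ hμ => Measure.le_iff.2 fun s hs => ?_
    rw [toMeasure_apply _ _ hs]
    have h2 : μ.toOuterMeasure ≤ closedCoverMeasure P := by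
      refine OuterMeasure.le_ofFunction.2 fun t => le_iInf fun n => ?_
      have h3 : t ⊆ {ω | (interval (initSeg ω n) ∩ t).Nonempty} :=
        fun ω hω => ⟨ω, mem_interval_initSeg ω n, hω⟩
      refine (measure_mono h3).trans ?_
      change μ _ ≤ _
      rw [measure_initSeg_eq_sum μ n fun x => (interval x ∩ t).Nonempty, levelMass,
        Finset.sum_filter]
      refine Finset.sum_le_sum fun x _ => ?_
      split_ifs
      · exact hμ x
      · exact le_rfl
    exact h2 s
  refine (h1 _).trans ?_
  rw [toMeasure_apply _ _ (measurableSet_interval y)]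
  refine (OuterMeasure.ofFunction_le _).trans ((iInf_le _ y.length).trans ?_)
  rw [levelMass, Finset.sum_eq_single y]
  · split_ifs <;> simp
  · intro x hx hxy
    rw [mem_strings] at hx
    rw [if_neg]
    rw [Set.not_nonempty_iff_eq_empty, ← Set.disjoint_iff_inter_eq_empty]
    exact interval_disjoint hx hxy
  · simp

theorem bar_le_sum (hP : IsSemimeasure P) {E : Set BinSeq} {F : Finset (List Bool)}
    (h : E ⊆ ⋃ x ∈ F, interval x) : bar P E ≤ ∑ x ∈ F, (P x : ℝ≥0∞) :=
  (measure_mono h).trans ((measure_biUnion_finset_le F _).trans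
    (Finset.sum_le_sum fun x _ => bar_interval_le hP x))

end MaximalMeasure

/-! ### Random sequences have positive probability. -/

section MaximalInequality

/-- A nonnegative supermartingale with initial value at most one exceeds `2` with probability
at most one half. -/
theorem two_mul_measure_exists_lt_le (μ : Measure BinSeq) [IsFiniteMeasure μ]
    {S : List Bool → ℝ≥0} (hS : IsSemimeasure S) (x : List Bool) (d : ℕ) :
    2 * μ {ω | ω ∈ interval x ∧ ∃ m ≤ d, 2 * μ (interval (initSeg ω (x.length + m))) <
      S (initSeg ω (x.length + m))} ≤ S x := by
  -- If the threshold is already exceeded at `x`, all of `interval x` counts and the bound is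
  -- immediate. Otherwise every crossing happens within one of the two children, with one level
  -- fewer.
  induction d generalizing x with
  | zero =>
    by_cases h : 2 * μ (interval x) < S x
    · exact (mul_le_mul_right (measure_mono fun ω hω => hω.1) _).trans h.le
    · refine le_of_eq_of_le ?_ zero_le
      rw [mul_eq_zero]
      right
      convert measure_empty (μ := μ)
      ext ω
      simp only [nonpos_iff_eq_zero, exists_eq_left, add_zero, Set.mem_ofPred_eq,
        Set.mem_empty_iff_false, iff_false]
      rintro ⟨h1, h2⟩
      rw [mem_interval.1 h1] at h2
      exact h h2
  | succ d ih =>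
    by_cases h : 2 * μ (interval x) < S x
    · exact (mul_le_mul_right (measure_mono fun ω hω => hω.1) _).trans h.le
    · refine le_trans ?_ ((add_le_add (ih (x ++ [false])) (ih (x ++ [true]))).trans
        (hS.split_le_coe x))
      rw [← mul_add]
      refine mul_le_mul_right ((measure_mono ?_).trans (measure_union_le _ _)) _
      rintro ω ⟨h1, m, hm, h2⟩
      rcases m with _ | m
      · rw [add_zero, mem_interval.1 h1] at h2
        exact absurd h2 h
      · have key : ∀ b, ω ∈ interval (x ++ [b]) → ω ∈ {ω | ω ∈ interval (x ++ [b]) ∧ ∃ m ≤ d,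
            2 * μ (interval (initSeg ω ((x ++ [b]).length + m))) <
              S (initSeg ω ((x ++ [b]).length + m))} := fun b hb => by
          refine ⟨hb, m, by omega, ?_⟩
          simpa [add_assoc, add_comm 1 m] using h2
        rw [interval_split] at h1
        exact h1.imp (key false) (key true)

/-- A nonrandom sequence has infinite deficiency, so its ratio exceeds `2` at some time. That event
has probability at most one half, by letting the horizon `d` grow. -/
theorem measure_randomSet_pos {Mpar : BinSeq → List Bool → ℝ≥0} {P : BinSeq → Measure BinSeq}
    (θ : BinSeq) [IsProbabilityMeasure (P θ)] (hS : IsSemimeasure (Mpar θ)) :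
    0 < P θ (randomSet Mpar P θ) := by
  have h1 : 2 * P θ {ω | ∃ m, 2 * P θ (interval (initSeg ω m)) < Mpar θ (initSeg ω m)} ≤ 1 := by
    have hU : {ω | ∃ m, 2 * P θ (interval (initSeg ω m)) < Mpar θ (initSeg ω m)} =
        ⋃ d : ℕ, {ω | ω ∈ interval [] ∧ ∃ m ≤ d,
          2 * P θ (interval (initSeg ω (([] : List Bool).length + m))) <
            Mpar θ (initSeg ω (([] : List Bool).length + m))} := by
      ext ω
      simp only [Set.mem_ofPred_eq, interval_nil, Set.mem_univ, true_and, Set.mem_iUnion,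
        List.length_nil, zero_add]
      exact ⟨fun ⟨m, hm⟩ => ⟨m, m, le_rfl, hm⟩, fun ⟨_, m, _, hm⟩ => ⟨m, hm⟩⟩
    rw [hU, Monotone.measure_iUnion, ENNReal.mul_iSup]
    · exact iSup_le fun d => (two_mul_measure_exists_lt_le (P θ) hS [] d).trans
        (by exact_mod_cast hS.root_le)
    · rintro d e hde ω ⟨h1, m, hm, h2⟩
      exact ⟨h1, m, hm.trans hde, h2⟩
  have h2 : (randomSet Mpar P θ)ᶜ ⊆
      {ω | ∃ m, 2 * P θ (interval (initSeg ω m)) < Mpar θ (initSeg ω m)} := by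
    intro ω hω
    have h3 : deficiency Mpar P θ ω = ∞ := not_lt_top_iff.1 hω
    have h4 : (2 : ℝ≥0∞) < deficiency Mpar P θ ω := by rw [h3]; exact ENNReal.ofNat_lt_top
    obtain ⟨m, hm⟩ := lt_iSup_iff.1 h4
    exact ⟨m, ENNReal.mul_lt_of_lt_div hm⟩
  by_contra h0
  have h0 : P θ (randomSet Mpar P θ) = 0 := by simpa using h0
  have h5 : (1 : ℝ≥0∞) ≤ P θ (randomSet Mpar P θ)ᶜ := by
    calc (1 : ℝ≥0∞) = P θ Set.univ := measure_univ.symm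
      _ ≤ P θ (randomSet Mpar P θ) + P θ (randomSet Mpar P θ)ᶜ := by
        rw [← Set.union_compl_self (randomSet Mpar P θ)]; exact measure_union_le _ _
      _ = _ := by rw [h0, zero_add]
  have h6 : (2 : ℝ≥0∞) * 1 ≤ 1 := (mul_le_mul_right (h5.trans (measure_mono h2)) 2).trans h1
  norm_num at h6

end MaximalInequality

/-! ### Translation between signed rational names and `frac`. -/

section RationalNames

variable {α : Type*} [Primcodable α]

/-- A negative rational is below every `x`; otherwise the truncated subtraction in the name is
exact. -/
theorem ratOf_lt_coe_iff (q : ℕ × ℕ × ℕ) (x : ℝ≥0) :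
    (ratOf q : ℝ) < x ↔ q.1 < q.2.1 ∨ frac (q.1 - q.2.1, q.2.2) < (x : ℝ≥0∞) := by
  rw [frac_lt_coe_iff]
  rcases lt_or_ge q.1 q.2.1 with h | h
  · simp only [h, true_or, iff_true]
    refine lt_of_lt_of_le ?_ x.2
    have h1 : (q.1 : ℚ) - q.2.1 < 0 := sub_neg.2 (by exact_mod_cast h)
    have h2 : ratOf q < 0 := div_neg_of_neg_of_pos h1 (by positivity)
    exact Rat.cast_lt_zero.2 h2
  · simp [ratOf, h.not_gt, Nat.cast_sub h]

theorem frac_lt_coe_iff_ratOf (p : ℕ × ℕ) (x : ℝ≥0) :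
    frac p < (x : ℝ≥0∞) ↔ (ratOf (p.1, 0, p.2) : ℝ) < x := by
  rw [frac_lt_coe_iff]; simp [ratOf]

theorem primrec_ratName : Primrec fun p : (ℕ × ℕ) × α => ((p.1.1, 0, p.1.2), p.2) :=
  ((Primrec.fst.comp Primrec.fst).pair ((Primrec.const 0).pair
    (Primrec.snd.comp Primrec.fst))).pair Primrec.snd

theorem LowerSemicomputable.paramLSC {M : List Bool → ℝ≥0} (h : LowerSemicomputable M) :
    ParamLSC fun _ x => (M x : ℝ≥0∞) :=
  (paramRE_const (rePred_comp h primrec_ratName.to_comp)).of_iff fun _ p =>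
    (frac_lt_coe_iff_ratOf p.1 (M p.2)).symm

theorem paramRE_ratOf_lt {R : BinSeq → α → ℝ≥0}
    (h : ParamLSC fun θ x => (R θ x : ℝ≥0∞)) :
    ParamRE fun θ (p : (ℕ × ℕ × ℕ) × α) => (ratOf p.1 : ℝ) < R θ p.2 := by
  have h1 : ParamRE fun _ (p : (ℕ × ℕ × ℕ) × α) => p.1.1 < p.1.2.1 :=
    paramRE_const (rePred_of_primrecPred (Primrec.nat_lt.comp (Primrec.fst.comp Primrec.fst)
      (Primrec.fst.comp (Primrec.snd.comp Primrec.fst))))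
  have h2 := ParamRE.comp h (g := fun p : (ℕ × ℕ × ℕ) × α =>
    ((p.1.1 - p.1.2.1, p.1.2.2), p.2)) (Primrec.to_comp (((Primrec.nat_sub.comp
      (Primrec.fst.comp Primrec.fst) (Primrec.fst.comp (Primrec.snd.comp Primrec.fst))).pair
      (Primrec.snd.comp (Primrec.snd.comp Primrec.fst))).pair Primrec.snd))
  exact (h1.or h2).of_iff fun θ p => (ratOf_lt_coe_iff p.1 (R θ p.2)).symm

theorem ParamLSC.paramLowerSemicomputable {R : BinSeq → List Bool → ℝ≥0}
    (h : ParamLSC fun θ x => (R θ x : ℝ≥0∞)) : ParamLowerSemicomputable R := by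
  obtain ⟨W, hW, h1⟩ := paramRE_ratOf_lt h
  exact ⟨fun x => W (x.1, x.2.1, x.2.2), hW, fun θ q x => h1 θ (q, x)⟩

theorem IsComputableFamily.paramLSC {P : BinSeq → Measure BinSeq} (hP : IsComputableFamily P) :
    ParamLSC fun θ x => P θ (interval x) := by
  obtain ⟨W, hW, h⟩ := hP.computable
  have := hP.prob
  -- The name `(2, 0, 0)` denotes `2`, which exceeds every probability, so only the lower bound is a
  -- condition.
  refine ⟨fun y => W (y.1, y.2.2, (y.2.1.1, 0, y.2.1.2), (2, 0, 0)), rePred_comp hW ?_, ?_⟩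
  · refine Primrec.to_comp (Primrec.fst.pair ((Primrec.snd.comp Primrec.snd).pair
      (Primrec.pair ?_ (Primrec.const _))))
    exact (Primrec.fst.comp (Primrec.fst.comp Primrec.snd)).pair ((Primrec.const 0).pair
      (Primrec.snd.comp (Primrec.fst.comp Primrec.snd)))
  · intro θ p
    simp only [← h]
    rw [frac_lt_iff (measure_ne_top _ _)]
    have h1 : (P θ).real (interval p.2) < 2 := (measureReal_le_one).trans_lt one_lt_two
    have h2 : ((ratOf (2, 0, 0) : ℚ) : ℝ) = 2 := by simp [ratOf]
    simp only [h2, h1, and_true]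
    simp [ratOf, Measure.real]

end RationalNames

/-! ### Computable parameters: positivity of `bar M`. -/

section ComputableParameter

theorem measure_interval_split (μ : Measure BinSeq) (x : List Bool) :
    μ (interval x) = μ (interval (x ++ [false])) + μ (interval (x ++ [true])) := by
  rw [interval_split, measure_union (interval_split_disjoint x) (measurableSet_interval _)]

theorem isSemimeasure_measure (μ : Measure BinSeq) [IsProbabilityMeasure μ] :
    IsSemimeasure fun x => (μ (interval x)).toNNReal := by
  refine ⟨?_, fun x => ?_⟩
  · simp
  · rw [measure_interval_split μ x, ENNReal.toNNReal_add (measure_ne_top _ _)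
      (measure_ne_top _ _)]

theorem bar_randomSet_pos {M : List Bool → ℝ≥0} (hM : IsUniversal M)
    {Mpar : BinSeq → List Bool → ℝ≥0} (hMpar : IsParamUniversal Mpar)
    {P : BinSeq → Measure BinSeq} (hP : IsComputableFamily P) {θ : BinSeq} (hθ : Computable θ) :
    0 < bar M (randomSet Mpar P θ) := by
  have := hP.prob
  have hcoe : ∀ θ x, ((P θ (interval x)).toNNReal : ℝ≥0∞) = P θ (interval x) := fun θ x =>
    ENNReal.coe_toNNReal (measure_ne_top _ _)
  have h1 : ParamLSC fun θ x => ((P θ (interval x)).toNNReal : ℝ≥0∞) := by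
    simpa only [hcoe] using hP.paramLSC
  obtain ⟨c, hc, hcM⟩ := hM.maximal (fun x => (P θ (interval x)).toNNReal)
    (isSemimeasure_measure (P θ)) ((paramRE_ratOf_lt h1).rePred hθ)
  have h2 : (c : ℝ≥0∞)⁻¹ • P θ ≤ bar M := by
    refine le_sSup fun x => ?_
    have h3 : P θ (interval x) ≤ c * M x := by
      rw [← hcoe]; exact_mod_cast hcM x
    rw [Measure.smul_apply, smul_eq_mul, mul_comm, ← div_eq_mul_inv]
    exact ENNReal.div_le_of_le_mul' h3
  refine lt_of_lt_of_le ?_ (h2 _)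
  rw [Measure.smul_apply, smul_eq_mul]
  exact ENNReal.mul_pos (by simp) (measure_randomSet_pos θ (hMpar.semimeasure θ)).ne'

end ComputableParameter

/-! ### Integer numerals of the initial segments of a parameter. -/

section Numerals

/-- The number with the given binary digits, the most significant digit first. -/
def binNum (σ : List Bool) : ℕ := σ.foldl (fun n b => 2 * n + b.toNat) 0

@[simp]
theorem binNum_append_singleton (σ : List Bool) (b : Bool) :
    binNum (σ ++ [b]) = 2 * binNum σ + b.toNat := by
  simp [binNum]

theorem primrec_binNum : Primrec binNum :=
  Primrec.list_foldl (f := fun σ : List Bool => σ) (g := fun _ => 0)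
    (h := fun _ p => 2 * p.1 + p.2.toNat) Primrec.id (Primrec.const 0)
    (Primrec.nat_add.comp (Primrec.nat_double.comp (Primrec.fst.comp Primrec.snd))
      ((Primrec.dom_bool Bool.toNat).comp (Primrec.snd.comp Primrec.snd)))

theorem binNum_initSeg_succ (θ : BinSeq) (k : ℕ) :
    binNum (initSeg θ (k + 1)) = 2 * binNum (initSeg θ k) + (θ k).toNat := by
  rw [initSeg_succ, binNum_append_singleton]

theorem binNum_initSeg_add_bounds (θ : BinSeq) (k d : ℕ) :
    2 ^ d * binNum (initSeg θ k) ≤ binNum (initSeg θ (k + d)) ∧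
      binNum (initSeg θ (k + d)) < 2 ^ d * (binNum (initSeg θ k) + 1) := by
  induction d with
  | zero => simp
  | succ d ih =>
    rw [← add_assoc, binNum_initSeg_succ, pow_succ]
    have : (θ (k + d)).toNat ≤ 1 := Bool.toNat_le _
    constructor <;> nlinarith [ih.1, ih.2]

theorem summable_value (θ : BinSeq) :
    Summable fun i : ℕ => (if θ i then (1 : ℝ) else 0) * (1 / 2) ^ (i + 1) := by
  refine Summable.of_nonneg_of_le (fun i => by positivity) (fun i => ?_)
    ((summable_nat_add_iff 1).2 summable_geometric_two)
  split_ifs <;> simp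

theorem sum_range_value (θ : BinSeq) (k : ℕ) :
    (∑ i ∈ Finset.range k, (if θ i then (1 : ℝ) else 0) * (1 / 2) ^ (i + 1)) * 2 ^ k =
      binNum (initSeg θ k) := by
  induction k with
  | zero => simp [binNum]
  | succ k ih =>
    rw [Finset.sum_range_succ, binNum_initSeg_succ, add_mul]
    push_cast
    rw [← ih, pow_succ]
    have : ((1 : ℝ) / 2) ^ (k + 1) * (2 ^ k * 2) = 1 := by
      rw [← pow_succ, ← mul_pow]; norm_num
    rw [mul_assoc, this]
    cases θ k <;> simp <;> ring

/-- Scaling by `2 ^ k` turns the first `k` digits into the integer `binNum` and the tail into a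
number in `[0, 1]`. The value `1` is attained by a tail of ones, so neither bound is strict. -/
theorem value_bounds (θ : BinSeq) (k : ℕ) :
    (binNum (initSeg θ k) : ℝ) ≤ value θ * 2 ^ k ∧
      value θ * 2 ^ k ≤ binNum (initSeg θ k) + 1 := by
  have h := (summable_value θ).sum_add_tsum_nat_add k
  rw [← value] at h
  rw [← h, add_mul, sum_range_value]
  have h1 : (∑' i : ℕ, (if θ (i + k) then (1 : ℝ) else 0) * (1 / 2) ^ (i + k + 1)) * 2 ^ k ≤ 1 := by
    rw [← tsum_mul_right]
    have h2 : (∑' i : ℕ, (1 / 2 : ℝ) ^ i * (1 / 2)) = 1 := by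
      rw [tsum_mul_right, tsum_geometric_two]; norm_num
    refine le_of_le_of_eq ?_ h2
    have h3 : ∀ i, (if θ (i + k) then (1 : ℝ) else 0) * (1 / 2) ^ (i + k + 1) * 2 ^ k ≤
        (1 / 2 : ℝ) ^ i * (1 / 2) := fun i => by
      have : ((1 : ℝ) / 2) ^ (i + k + 1) * 2 ^ k = (1 / 2) ^ i * (1 / 2) := by
        rw [add_right_comm, pow_add, mul_assoc, ← mul_pow, ← pow_succ]; norm_num
      rw [mul_assoc, this]
      split_ifs
      · rw [one_mul]
      · rw [zero_mul]; positivity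
    refine Summable.tsum_le_tsum h3 (((summable_nat_add_iff k).2 (summable_value θ)).mul_right _)
      (summable_geometric_two.mul_right _)
  have h2 : 0 ≤ (∑' i : ℕ, (if θ (i + k) then (1 : ℝ) else 0) * (1 / 2) ^ (i + k + 1)) * 2 ^ k := by
    refine mul_nonneg (tsum_nonneg fun i => ?_) (by positivity)
    split_ifs <;> positivity
  constructor <;> linarith

end Numerals

/-! ### Finite tables of estimates that are good for all parameters. -/

section Tables

/-- The distance of two numbers is at most `d`. -/
def Near (d a b : ℕ) : Prop := a ≤ b + d ∧ b ≤ a + d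

instance (d a b : ℕ) : Decidable (Near d a b) := inferInstanceAs (Decidable (_ ∧ _))

theorem primrecPred_near {α : Type*} [Primcodable α] (d : ℕ) {f g : α → ℕ} (hf : Primrec f)
    (hg : Primrec g) : PrimrecPred fun a => Near d (f a) (g a) :=
  (Primrec.nat_le.comp hf (Primrec.nat_add.comp hg (Primrec.const d))).and
    (Primrec.nat_le.comp hg (Primrec.nat_add.comp hf (Primrec.const d)))

/-- The entry for the string `z` in a table of natural numbers. -/
def entry (t : List ℕ) (z : List Bool) : ℕ := t.getD (Encodable.encode z) 0

theorem primrec_entry {α : Type*} [Primcodable α] {f : α → List ℕ} {g : α → List Bool}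
    (hf : Primrec f) (hg : Primrec g) : Primrec fun a => entry (f a) (g a) :=
  (Primrec.list_getD 0).comp hf (Primrec.encode.comp hg)

/-- On one length an arbitrary, possibly noncomputable, `g` is a finite object and can therefore be
found by search. -/
theorem exists_entry_eq (n : ℕ) (g : List Bool → ℕ) : ∃ t, ∀ z, z.length = n → entry t z = g z := by
  refine ⟨(List.range ((strings n).sup Encodable.encode + 1)).map fun e =>
    ((Encodable.decode (α := List Bool) e).map g).getD 0, fun z hz => ?_⟩
  have h : Encodable.encode z < (strings n).sup Encodable.encode + 1 :=
    Nat.lt_succ_of_le (Finset.le_sup (f := Encodable.encode) (mem_strings.2 hz))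
  simp [entry, h]

/-- The segment of length `g a` is the only string of that length that the oracle confirms. So for a
decidable `q`, both `q` and its negation can be enumerated. -/
theorem paramRE_initSeg {α : Type*} [Primcodable α] {q : α × List Bool → Prop} (hq : REPred q)
    {g : α → ℕ} (hg : Primrec g) : ParamRE fun θ a => q (a, initSeg θ (g a)) := by
  have h1 : ParamRE fun θ (x : α × List Bool) => θ ∈ interval x.2 :=
    paramRE_mem_interval.comp Computable.snd
  have h2 : ParamRE fun _ (x : α × List Bool) => x.2.length = g x.1 :=
    paramRE_const (rePred_of_primrecPred (Primrec.eq.comp (Primrec.list_length.comp Primrec.snd)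
      (hg.comp Primrec.fst)))
  refine (h1.and (h2.and (paramRE_const hq))).exists.of_iff fun θ a => ⟨?_, fun h => ?_⟩
  · rintro ⟨σ, h3, h4, h5⟩
    rw [mem_interval, h4] at h3
    rwa [h3]
  · exact ⟨_, mem_interval_initSeg θ (g a), length_initSeg _ _, h⟩

/-- A string is correct, with respect to a table of estimates for strings of a given length, if
its entry is close to the numeral of the initial segment of the parameter. -/
def Correct (T : ℕ × List ℕ) (k : ℕ) (θ : BinSeq) (z : List Bool) : Prop :=
  Near 2 (entry T.2 z) (binNum (initSeg θ k))

instance (T : ℕ × List ℕ) (k : ℕ) (θ : BinSeq) : DecidablePred (Correct T k θ) :=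
  fun _ => inferInstanceAs (Decidable (Near _ _ _))

theorem primrecPred_near_entry :
    PrimrecPred fun x : ((ℕ × (ℕ × List ℕ)) × List Bool) × List Bool =>
      Near 2 (entry x.1.1.2.2 x.1.2) (binNum x.2) :=
  primrecPred_near 2 (primrec_entry (Primrec.snd.comp (Primrec.snd.comp
    (Primrec.fst.comp Primrec.fst))) (Primrec.snd.comp Primrec.fst))
    (primrec_binNum.comp Primrec.snd)

theorem primrecPred_length_eq :
    PrimrecPred fun x : ((ℕ × (ℕ × List ℕ)) × List Bool) => x.2.length = x.1.2.1 :=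
  Primrec.eq.comp (Primrec.list_length.comp Primrec.snd)
    (Primrec.fst.comp (Primrec.snd.comp Primrec.fst))

theorem paramRE_correct : ParamRE fun θ (x : (ℕ × (ℕ × List ℕ)) × List Bool) =>
    x.2.length = x.1.2.1 ∧ Correct x.1.2 x.1.1 θ x.2 :=
  (paramRE_const (rePred_of_primrecPred primrecPred_length_eq)).and
    (paramRE_initSeg (rePred_of_primrecPred primrecPred_near_entry)
      (Primrec.fst.comp Primrec.fst))

theorem paramRE_not_correct : ParamRE fun θ (x : (ℕ × (ℕ × List ℕ)) × List Bool) =>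
    x.2.length = x.1.2.1 ∧ ¬ Correct x.1.2 x.1.1 θ x.2 :=
  (paramRE_const (rePred_of_primrecPred primrecPred_length_eq)).and
    (paramRE_initSeg (rePred_of_primrecPred primrecPred_near_entry.not)
      (Primrec.fst.comp Primrec.fst))

/-- One unit of the tolerance pays for the error of the estimate at scale `2 ^ k`, the other for the
rounding of `e` or of `v`. -/
theorem near_floor {e v : ℝ} {k a : ℕ} (he : 0 ≤ e) (hev : |e - v| ≤ 1 / 2 ^ k)
    (h1 : (a : ℝ) ≤ v * 2 ^ k) (h2 : v * 2 ^ k ≤ a + 1) : Near 2 ⌊e * 2 ^ k⌋₊ a := by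
  have hp : (0 : ℝ) < 2 ^ k := by positivity
  have h3 := Nat.floor_le (a := e * 2 ^ k) (by positivity)
  have h4 := Nat.lt_floor_add_one (e * 2 ^ k)
  rw [le_div_iff₀ hp] at hev
  have h5 : |e * 2 ^ k - v * 2 ^ k| ≤ 1 := by
    rwa [← sub_mul, abs_mul, abs_of_pos hp]
  rw [abs_le] at h5
  constructor
  · have : (⌊e * 2 ^ k⌋₊ : ℝ) ≤ a + 2 := by linarith
    exact_mod_cast this
  · have : (a : ℝ) ≤ (⌊e * 2 ^ k⌋₊ : ℝ) + 2 := by linarith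
    exact_mod_cast this

theorem exists_table {P : BinSeq → Measure BinSeq} [∀ θ, IsProbabilityMeasure (P θ)]
    {est : List Bool → Set.Icc (0 : ℝ) 1} (hest : EffectivelyStrictlyConsistent P est) (k u : ℕ) :
    ∃ T : ℕ × List ℕ, ∀ θ,
      frac (u, u) < P θ {ω | Correct T k θ (initSeg ω T.1)} := by
  obtain ⟨N, -, hN⟩ := hest
  -- The admissible failure probability `1 / (u + 2)` is strictly below `1 / (u + 1) = 1 - u / (u +
  -- 1)`, which makes the final inequality strict and hence enumerable.
  set n := N (1 / 2 ^ k) (1 / (u + 2)) with hn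
  obtain ⟨t, ht⟩ := exists_entry_eq n fun z => ⌊(est z : ℝ) * 2 ^ k⌋₊
  refine ⟨(n, t), fun θ => ?_⟩
  rw [frac_lt_iff (measure_ne_top _ _), ← Measure.real]
  have h1 := hN θ (1 / 2 ^ k) (1 / (u + 2)) (by positivity) (by positivity)
  rw [← hn] at h1
  set bad := {ω | ∃ m, n ≤ m ∧
    ((1 / 2 ^ k : ℚ) : ℝ) < |(est (initSeg ω m) : ℝ) - value θ|} with hbad
  have h2 : Set.univ ⊆ {ω | Correct (n, t) k θ (initSeg ω n)} ∪ bad := by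
    intro ω _
    by_cases hω : ω ∈ bad
    · exact Or.inr hω
    · left
      simp only [hbad, Set.mem_ofPred_eq, not_exists, not_and, not_lt] at hω
      have h3 := hω n le_rfl
      push_cast at h3
      change Near 2 (entry t (initSeg ω n)) _
      rw [ht _ (length_initSeg _ _)]
      exact near_floor (est _).2.1 h3 (value_bounds θ k).1 (value_bounds θ k).2
  have h3 : 1 ≤ (P θ).real {ω | Correct (n, t) k θ (initSeg ω n)} + (P θ).real bad := by
    rw [← probReal_univ (μ := P θ)]
    exact (measureReal_mono h2).trans (measureReal_union_le _ _)
  push_cast at h1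
  have h4 : (1 : ℝ) / (u + 2) < 1 / (u + 1) := by
    apply one_div_lt_one_div_of_lt <;> [positivity; linarith]
  have h5 : (u : ℝ) / (u + 1) = 1 - 1 / (u + 1) := by field_simp; ring
  simp only [h5]
  linarith

/-- Since the parameter space is compact, tables of estimates that are correct with high
probability, uniformly in the parameter, can be computed. -/
theorem exists_computable_tables {P : BinSeq → Measure BinSeq} (hP : IsComputableFamily P)
    {est : List Bool → Set.Icc (0 : ℝ) 1} (hest : EffectivelyStrictlyConsistent P est)
    {u : ℕ → ℕ} (hu : Primrec u) :
    ∃ T : ℕ → ℕ × List ℕ, Computable T ∧ ∀ k θ, frac (u k, u k) <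
        P θ {ω | Correct (T k) k θ (initSeg ω (T k).1)} := by
  classical
  have := hP.prob
  have h1 : ParamLSC fun θ (x : (ℕ × (ℕ × List ℕ)) × List Bool) =>
      if x.2.length = x.1.2.1 ∧ Correct x.1.2 x.1.1 θ x.2 then P θ (interval x.2) else 0 := by
    convert (hP.paramLSC.comp Computable.snd).ite paramRE_correct
  have h2 := h1.tsum fun θ x => by split_ifs <;> simp
  have h3 : ParamRE fun θ (x : ℕ × (ℕ × List ℕ)) =>
      frac (u x.1, u x.1) <
        P θ {ω | Correct x.2 x.1 θ (initSeg ω x.2.1)} := by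
    have hp : Primrec fun x : ℕ × (ℕ × List ℕ) => u x.1 := hu.comp Primrec.fst
    refine (ParamRE.comp h2 (g := fun x : ℕ × (ℕ × List ℕ) =>
      ((u x.1, u x.1), x)) ((hp.pair hp).pair Primrec.id).to_comp).of_iff
        fun θ x => ?_
    rw [measure_initSeg_eq_sum, ← tsum_strings]
  -- The estimator only guarantees that the search for a table succeeds.
  exact exists_computable_choice h3.rePred_forall fun k => exists_table hest k (u k)

end Tables

/-! ### A randomness test that penalizes incorrect tables. -/

section RandomnessTest

variable {P : BinSeq → Measure BinSeq}

/-- Two intervals are nested or disjoint. A supremum over common extensions covers all cases and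
preserves lower semicomputability. -/
theorem measure_inter_interval (μ : Measure BinSeq) (x z : List Bool)
    [∀ y, Decidable (x <+: y ∧ z <+: y)] :
    μ (interval x ∩ interval z) =
      ⨆ y, if x <+: y ∧ z <+: y then μ (interval y) else 0 := by
  apply le_antisymm
  · rcases Set.eq_empty_or_nonempty (interval x ∩ interval z) with h | ⟨ω, hx, hz⟩
    · simp [h]
    · rcases le_total x.length z.length with h | h
      · refine le_iSup_of_le z ?_
        rw [if_pos ⟨prefix_of_mem_interval hx hz h, List.prefix_rfl⟩]
        exact measure_mono Set.inter_subset_right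
      · refine le_iSup_of_le x ?_
        rw [if_pos ⟨List.prefix_rfl, prefix_of_mem_interval hz hx h⟩]
        exact measure_mono Set.inter_subset_left
  · refine iSup_le fun y => ?_
    split_ifs with h
    · exact measure_mono (Set.subset_inter (interval_subset_of_prefix h.1)
        (interval_subset_of_prefix h.2))
    · exact zero_le

theorem primrecPred_prefix {α : Type*} [Primcodable α] {f g : α → List Bool} (hf : Primrec f)
    (hg : Primrec g) : PrimrecPred fun a => f a <+: g a :=
  (Primrec.eq.comp hf (Primrec.list_take.comp (Primrec.list_length.comp hf) hg)).of_eq fun _ =>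
    List.prefix_iff_eq_take.symm

theorem paramLSC_inter_interval (hP : ParamLSC fun θ x => P θ (interval x)) :
    ParamLSC fun θ (x : List Bool × List Bool) => P θ (interval x.1 ∩ interval x.2) := by
  classical
  simp only [measure_inter_interval]
  refine ParamLSC.iSup (f := fun θ (x : (List Bool × List Bool) × List Bool) =>
    if x.1.1 <+: x.2 ∧ x.1.2 <+: x.2 then P θ (interval x.2) else 0) ?_
  convert (hP.comp (g := fun x : (List Bool × List Bool) × List Bool => x.2) Computable.snd).ite
    (paramRE_const (rePred_of_primrecPred ((primrecPred_prefix (Primrec.fst.comp Primrec.fst)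
      Primrec.snd).and (primrecPred_prefix (Primrec.snd.comp Primrec.fst) Primrec.snd))))

/-- The semimeasure that exceeds `P θ` by the factor `2 ^ k` on the sequences for which the
table `T k` is not correct. -/
def errorTest (P : BinSeq → Measure BinSeq) (T : ℕ → ℕ × List ℕ) (θ : BinSeq) (x : List Bool) :
    ℝ≥0∞ :=
  ∑' p : ℕ × List Bool, if p.2.length = (T p.1).1 ∧ ¬ Correct (T p.1) p.1 θ p.2 then
    2 ^ p.1 * P θ (interval x ∩ interval p.2) else 0

variable {T : ℕ → ℕ × List ℕ}

theorem paramLSC_errorTest (hP : IsComputableFamily P) (hT : Computable T) :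
    ParamLSC (errorTest P T) := by
  classical
  have := hP.prob
  refine ParamLSC.tsum (f := fun θ (y : List Bool × (ℕ × List Bool)) =>
    if y.2.2.length = (T y.2.1).1 ∧ ¬ Correct (T y.2.1) y.2.1 θ y.2.2 then
      2 ^ y.2.1 * P θ (interval y.1 ∩ interval y.2.2) else 0) ?_ fun θ y => ?_
  · have h1 : ParamLSC fun θ (y : List Bool × (ℕ × List Bool)) =>
        P θ (interval y.1 ∩ interval y.2.2) :=
      (paramLSC_inter_interval hP.paramLSC).comp
        (g := fun y : List Bool × (ℕ × List Bool) => (y.1, y.2.2))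
        (Primrec.to_comp (Primrec.fst.pair (Primrec.snd.comp Primrec.snd)))
    have h2 : Computable fun y : List Bool × (ℕ × List Bool) => ((y.2.1, T y.2.1), y.2.2) :=
      ((Computable.fst.comp Computable.snd).pair
        (hT.comp (Computable.fst.comp Computable.snd))).pair (Computable.snd.comp Computable.snd)
    convert (h1.two_pow_mul (Primrec.fst.comp Primrec.snd)).ite (paramRE_not_correct.comp h2)
  · split_ifs
    · exact ENNReal.mul_ne_top (by simp) (measure_ne_top _ _)
    · simp

theorem errorTest_split_le (θ : BinSeq) (x : List Bool) :
    errorTest P T θ (x ++ [false]) + errorTest P T θ (x ++ [true]) ≤ errorTest P T θ x := by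
  rw [errorTest, errorTest, ← ENNReal.tsum_add]
  refine ENNReal.tsum_le_tsum fun p => ?_
  split_ifs
  · rw [← mul_add]
    refine mul_le_mul_right (le_of_eq ?_) _
    rw [interval_split x, Set.union_inter_distrib_right, measure_union _
      ((measurableSet_interval _).inter (measurableSet_interval _))]
    exact (interval_split_disjoint x).mono Set.inter_subset_left Set.inter_subset_left
  · simp

theorem measure_compl_le_of_frac_lt (μ : Measure BinSeq) [IsProbabilityMeasure μ]
    {s : Set BinSeq} (hs : MeasurableSet s) {u : ℕ} (h : frac (u, u) < μ s) :
    μ sᶜ ≤ (u : ℝ≥0∞)⁻¹ := by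
  rcases Nat.eq_zero_or_pos u with rfl | hu
  · simp
  rw [frac_lt_iff (measure_ne_top _ _), ← Measure.real] at h
  have hu' : (0 : ℝ) < u := by exact_mod_cast hu
  have h1 : μ.real sᶜ ≤ (u : ℝ)⁻¹ := by
    rw [probReal_compl_eq_one_sub hs]
    have h2 : (u : ℝ) / (u + 1) = 1 - (u + 1 : ℝ)⁻¹ := by field_simp; ring
    have h3 : ((u : ℝ) + 1)⁻¹ ≤ (u : ℝ)⁻¹ := by gcongr; linarith
    simp only [h2] at h
    linarith
  rw [← ENNReal.ofReal_toReal (measure_ne_top μ sᶜ), ← ENNReal.ofReal_natCast,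
    ← ENNReal.ofReal_inv_of_pos hu']
  exact ENNReal.ofReal_le_ofReal h1

/-- The error probability `2 ^ (-(2k + 1))` times the weight `2 ^ k` leaves `2 ^ (-(k + 1))`, and
these numbers sum to one. -/
theorem errorTest_nil_le [∀ θ, IsProbabilityMeasure (P θ)] (θ : BinSeq)
    (hT : ∀ k, frac (2 ^ (2 * k + 1), 2 ^ (2 * k + 1)) <
      P θ {ω | Correct (T k) k θ (initSeg ω (T k).1)}) : errorTest P T θ [] ≤ 1 := by
  have h1 : ∀ k, (∑' z : List Bool, if z.length = (T k).1 ∧ ¬ Correct (T k) k θ z then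
      2 ^ k * P θ (interval z) else 0) ≤ 2⁻¹ ^ (k + 1) := fun k => by
    have h2 := measure_compl_le_of_frac_lt (P θ)
      (measurableSet_initSeg (T k).1 (Correct (T k) k θ)) (hT k)
    rw [Set.compl_ofPred, measure_initSeg_eq_sum (P θ) (T k).1 fun z => ¬ Correct (T k) k θ z] at h2
    rw [tsum_strings, ← Finset.mul_sum]
    refine (mul_le_mul_right h2 _).trans (le_of_eq ?_)
    have h3 : ((2 ^ (2 * k + 1) : ℕ) : ℝ≥0∞) = 2 ^ k * 2 ^ (k + 1) := by
      rw [← pow_add, show k + (k + 1) = 2 * k + 1 by ring]; norm_num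
    rw [h3, ENNReal.mul_inv (by simp) (by simp), ← mul_assoc,
      ENNReal.mul_inv_cancel (by simp) (by simp), one_mul, ENNReal.inv_pow]
  calc errorTest P T θ [] = ∑' k, ∑' z : List Bool,
        if z.length = (T k).1 ∧ ¬ Correct (T k) k θ z then 2 ^ k * P θ (interval z) else 0 := by
        simp only [errorTest, interval_nil, Set.univ_inter]
        exact ENNReal.tsum_prod (f := fun k z => if z.length = (T k).1 ∧ ¬ Correct (T k) k θ z
          then 2 ^ k * P θ (interval z) else 0)
    _ ≤ ∑' k : ℕ, (2⁻¹ : ℝ≥0∞) ^ (k + 1) := ENNReal.tsum_le_tsum h1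
    _ = 1 := by
        rw [ENNReal.tsum_geometric_add_one, ENNReal.one_sub_inv_two, inv_inv,
          ENNReal.inv_mul_cancel (by simp) (by simp)]

theorem le_errorTest {θ ω : BinSeq} {k n : ℕ} (hn : (T k).1 ≤ n)
    (h : ¬ Correct (T k) k θ (initSeg ω (T k).1)) :
    2 ^ k * P θ (interval (initSeg ω n)) ≤ errorTest P T θ (initSeg ω n) := by
  refine le_trans ?_ (ENNReal.le_tsum (k, initSeg ω (T k).1))
  rw [if_pos ⟨length_initSeg _ _, h⟩,
    Set.inter_eq_left.2 (interval_subset_of_prefix (initSeg_prefix ω hn))]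

theorem isSemimeasure_of_coe {R : List Bool → ℝ≥0∞} (h0 : R [] ≤ 1)
    (h : ∀ x, R (x ++ [false]) + R (x ++ [true]) ≤ R x) :
    (∀ x, R x ≠ ∞) ∧ IsSemimeasure fun x => (R x).toNNReal := by
  have h1 : ∀ x, R x ≤ 1 := fun x => by
    induction x using List.reverseRecOn with
    | nil => exact h0
    | append_singleton x b ih =>
      refine le_trans ?_ ((h x).trans ih)
      cases b
      · exact le_self_add
      · exact le_add_self
  have h2 : ∀ x, R x ≠ ∞ := fun x => ne_top_of_le_ne_top ENNReal.one_ne_top (h1 x)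
  refine ⟨h2, ⟨?_, fun x => ?_⟩⟩
  · exact ENNReal.toNNReal_mono ENNReal.one_ne_top h0
  · rw [← ENNReal.toNNReal_add (h2 _) (h2 _)]
    exact ENNReal.toNNReal_mono (h2 _) (h x)

theorem IsParamUniversal.exists_le_mul {Mpar : BinSeq → List Bool → ℝ≥0}
    (hMpar : IsParamUniversal Mpar) {R : BinSeq → List Bool → ℝ≥0∞} (h0 : ∀ θ, R θ [] ≤ 1)
    (h : ∀ θ x, R θ (x ++ [false]) + R θ (x ++ [true]) ≤ R θ x) (hR : ParamLSC R) :
    ∃ c : ℝ≥0, ∀ θ x, R θ x ≤ c * Mpar θ x := by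
  have h1 := fun θ => isSemimeasure_of_coe (h0 θ) (h θ)
  have h2 : ∀ θ x, ((R θ x).toNNReal : ℝ≥0∞) = R θ x := fun θ x =>
    ENNReal.coe_toNNReal ((h1 θ).1 x)
  obtain ⟨c, -, hc⟩ := hMpar.maximal (fun θ x => (R θ x).toNNReal) (fun θ => (h1 θ).2)
    (ParamLSC.paramLowerSemicomputable (by simpa only [h2] using hR))
  refine ⟨c, fun θ x => ?_⟩
  rw [← h2]
  exact_mod_cast hc θ x

/-- `Mpar` dominates the uniform distribution. Consequently finite deficiency at `ω` forces `P θ` to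
be positive on every initial segment of `ω`. -/
theorem IsParamUniversal.pos {Mpar : BinSeq → List Bool → ℝ≥0}
    (hMpar : IsParamUniversal Mpar) (θ : BinSeq) (x : List Bool) : Mpar θ x ≠ 0 := by
  have h1 : ParamLSC fun _ (x : List Bool) => (2⁻¹ : ℝ≥0∞) ^ x.length := by
    refine (paramRE_const (p := fun p : (ℕ × ℕ) × List Bool =>
      p.1.1 * 2 ^ p.2.length < p.1.2 + 1) (rePred_of_primrecPred (Primrec.nat_lt.comp
        (Primrec.nat_mul.comp (Primrec.fst.comp Primrec.fst)
          (primrec_two_pow.comp (Primrec.list_length.comp Primrec.snd)))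
        (Primrec.succ.comp (Primrec.snd.comp Primrec.fst))))).of_iff fun _ p => ?_
    change _ ↔ frac p.1 < (2⁻¹ : ℝ≥0∞) ^ p.2.length
    rw [← ENNReal.inv_pow, frac, ENNReal.div_lt_iff (by simp) (by simp),
      mul_comm ((2 : ℝ≥0∞) ^ p.2.length)⁻¹,
      ← div_eq_mul_inv, ENNReal.lt_div_iff_mul_lt (by simp) (by simp)]
    exact_mod_cast Iff.rfl
  obtain ⟨c, hc⟩ := hMpar.exists_le_mul (R := fun _ x => (2⁻¹ : ℝ≥0∞) ^ x.length) (by simp)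
    (fun θ x => by simp [pow_succ, ← mul_add, ENNReal.inv_two_add_inv_two]) h1
  intro h
  have := hc θ x
  simp [h] at this

/-- For a random sequence all but finitely many of the computed tables are correct. -/
theorem exists_forall_correct {Mpar : BinSeq → List Bool → ℝ≥0} (hMpar : IsParamUniversal Mpar)
    (hP : IsComputableFamily P) (hTc : Computable T)
    (hT : ∀ k θ, frac (2 ^ (2 * k + 1), 2 ^ (2 * k + 1)) <
      P θ {ω | Correct (T k) k θ (initSeg ω (T k).1)}) {θ ω : BinSeq}
    (hω : ω ∈ randomSet Mpar P θ) : ∃ K, ∀ k ≥ K, Correct (T k) k θ (initSeg ω (T k).1) := by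
  have := hP.prob
  obtain ⟨c, hc⟩ := hMpar.exists_le_mul (fun θ => errorTest_nil_le θ fun k => hT k θ)
    errorTest_split_le (paramLSC_errorTest hP hTc)
  have hω : deficiency Mpar P θ ω < ∞ := hω
  have hD : ∀ n, (Mpar θ (initSeg ω n) : ℝ≥0∞) ≤
      deficiency Mpar P θ ω * P θ (interval (initSeg ω n)) := fun n =>
    (ENNReal.div_le_iff_le_mul (Or.inr hω.ne) (Or.inl (measure_ne_top _ _))).1
      (le_iSup (fun n => (Mpar θ (initSeg ω n) : ℝ≥0∞) / P θ (interval (initSeg ω n))) n)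
  have hp : ∀ n, P θ (interval (initSeg ω n)) ≠ 0 := fun n h => by
    have h1 := hD n
    rw [h, mul_zero] at h1
    exact hMpar.pos θ (initSeg ω n) (by simpa using h1)
  have hfin : (c : ℝ≥0∞) * deficiency Mpar P θ ω ≠ ∞ :=
    ENNReal.mul_ne_top ENNReal.coe_ne_top hω.ne
  -- An incorrect table `k` would give `2 ^ k * P ≤ errorTest ≤ c * Mpar ≤ c * deficiency * P` on a
  -- segment of `ω`, so `2 ^ k` is at most the finite number `c * deficiency`.
  obtain ⟨K, hK⟩ := ENNReal.exists_nat_gt hfin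
  refine ⟨K, fun k hk => ?_⟩
  by_contra h
  have h1 : 2 ^ k * P θ (interval (initSeg ω (T k).1)) ≤
      c * deficiency Mpar P θ ω * P θ (interval (initSeg ω (T k).1)) :=
    (le_errorTest le_rfl h).trans ((hc θ _).trans (by
      rw [mul_assoc]; exact mul_le_mul_right (hD _) _))
  rw [ENNReal.mul_le_mul_iff_left (hp _) (measure_ne_top _ _)] at h1
  have h2 : (K : ℝ≥0∞) ≤ 2 ^ k := by
    exact_mod_cast hk.trans k.lt_two_pow_self.le
  exact absurd (hK.trans_le h2) h1.not_gt

end RandomnessTest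

/-! ### Computing the parameter from a set of positive maximal measure. -/

section ApproximationOfTheParameter

/-- A set of positive maximal measure has a cover whose mass is less than twice a rational lower
bound of the masses of all its covers. -/
theorem exists_cover_lt_two_mul {M : List Bool → ℝ≥0} (hM : IsSemimeasure M) {E : Set BinSeq}
    (hE : 0 < bar M E) : ∃ (n : ℕ) (F : Finset (List Bool)) (p : ℕ × ℕ), F ⊆ strings n ∧
      E ⊆ (⋃ x ∈ F, interval x) ∧ ∑ x ∈ F, (M x : ℝ≥0∞) < 2 * frac p ∧
      ∀ m, ∀ G ⊆ strings m, E ⊆ (⋃ x ∈ G, interval x) → frac p < ∑ x ∈ G, (M x : ℝ≥0∞) := by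
  -- The infimum of the masses of covers is positive, because it is at least `bar M E`, and finite.
  -- So some cover has mass below `2 * q`, and `p` is chosen between half of that mass and `q`.
  set q : ℝ≥0∞ := ⨅ i : {i : ℕ × Finset (List Bool) // i.2 ⊆ strings i.1 ∧
    E ⊆ ⋃ x ∈ i.2, interval x}, ∑ x ∈ i.1.2, (M x : ℝ≥0∞) with hq
  have h0 : 0 < q := hE.trans_le (le_iInf fun i => bar_le_sum hM i.2.2)
  have h1 : q ≠ ∞ := by
    refine ne_top_of_le_ne_top ?_ (iInf_le _ ⟨(0, strings 0), subset_rfl, fun ω _ => ?_⟩)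
    · exact ENNReal.sum_ne_top.2 fun x _ => ENNReal.coe_ne_top
    · exact Set.mem_biUnion (mem_strings.2 rfl) (by simp : ω ∈ interval [])
  have h2 : q < 2 * q := by
    rw [two_mul]; exact ENNReal.lt_add_right h1 h0.ne'
  obtain ⟨⟨⟨n, F⟩, hF, hEF⟩, h3⟩ := iInf_lt_iff.1 h2
  have h4 : (∑ x ∈ F, (M x : ℝ≥0∞)) / 2 < q := by
    rw [ENNReal.div_lt_iff (by simp) (by simp), mul_comm]; exact h3
  obtain ⟨p, h5, h6⟩ := exists_frac_btwn h4
  rw [ENNReal.div_lt_iff (by simp) (by simp), mul_comm] at h5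
  refine ⟨n, F, p, hF, hEF, h5, fun m G hG hEG => h6.trans_le ?_⟩
  exact iInf_le_of_le ⟨(m, G), hG, hEG⟩ le_rfl

theorem near_trans {a b c : ℕ} (h1 : Near 2 a b) (h2 : Near 2 a c) : Near 4 b c := by
  unfold Near at *; omega

/-- If a set of sequences of positive maximal measure agrees on the estimates of the parameter,
then these estimates can be computed. -/
theorem exists_computable_near {M : List Bool → ℝ≥0} (hM : IsSemimeasure M)
    (hMl : LowerSemicomputable M) {T : ℕ → ℕ × List ℕ} (hT : Computable T) {θ : BinSeq}
    {E : Set BinSeq} (hE : 0 < bar M E) {K : ℕ}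
    (hEK : ∀ ω ∈ E, ∀ k ≥ K, Correct (T k) k θ (initSeg ω (T k).1)) :
    ∃ J : ℕ → ℕ, Computable J ∧ ∀ k, Near 4 (J k) (binNum (initSeg θ (k + K))) := by
  classical
  obtain ⟨n, F, p, hF, hEF, hlt, hcov⟩ := exists_cover_lt_two_mul hM hE
  -- The string `x` continues a member of the cover, and its table entry supports the numeral `j`.
  let C : (ℕ × List ℕ) → ℕ → List Bool → Prop := fun t j x =>
    x.take n ∈ F ∧ Near 2 (entry t.2 (x.take t.1)) j
  have hre : REPred fun y : ℕ × ℕ => frac p <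
      ∑ x ∈ strings (max n (T (y.1 + K)).1) with C (T (y.1 + K)) y.2 x, (M x : ℝ≥0∞) := by
    have h1 : PrimrecPred fun y : ((ℕ × List ℕ) × ℕ) × List Bool =>
        y.2.length = max n y.1.1.1 ∧ C y.1.1 y.1.2 y.2 := by
      have hF' : PrimrecPred fun y : ((ℕ × List ℕ) × ℕ) × List Bool => y.2.take n ∈ F :=
        ((Primrec.eq (α := List Bool)).exists_mem_list.comp (Primrec.const F.toList)
          (Primrec.list_take.comp (Primrec.const n) Primrec.snd)).of_eq fun y => by simp
      exact (Primrec.eq.comp (Primrec.list_length.comp Primrec.snd) (Primrec.nat_max.comp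
        (Primrec.const n) (Primrec.fst.comp (Primrec.fst.comp Primrec.fst)))).and (hF'.and
          (primrecPred_near 2 (primrec_entry (Primrec.snd.comp (Primrec.fst.comp Primrec.fst))
            (Primrec.list_take.comp (Primrec.fst.comp (Primrec.fst.comp Primrec.fst)) Primrec.snd))
            (Primrec.snd.comp Primrec.fst)))
    have h2 : Computable fun y : (ℕ × ℕ) × List Bool => ((T (y.1.1 + K), y.1.2), y.2) :=
      ((hT.comp (Primrec.to_comp (Primrec.nat_add.comp (Primrec.fst.comp Primrec.fst)
        (Primrec.const K)))).pair (Computable.snd.comp Computable.fst)).pair Computable.snd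
    have h3 : ParamLSC fun _ (y : (ℕ × ℕ) × List Bool) =>
        if y.2.length = max n (T (y.1.1 + K)).1 ∧ C (T (y.1.1 + K)) y.1.2 y.2 then
          (M y.2 : ℝ≥0∞) else 0 := by
      convert (hMl.paramLSC.comp Computable.snd).ite
        (paramRE_const (rePred_comp (rePred_of_primrecPred h1) h2))
    have h4 := ParamRE.comp (h3.tsum fun _ y => by split_ifs <;> simp)
      (g := fun y : ℕ × ℕ => (p, y)) ((Computable.const p).pair Computable.id)
    -- Nothing here depends on the oracle, so any computable sequence may take its place.
    refine (h4.rePred (Computable.const false)).of_eq fun y => ?_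
    rw [← tsum_strings]
  -- The strings supporting the true numeral still cover `E`, so `p` bounds their mass from below.
  have hθ : ∀ k ≥ K, frac p <
      ∑ x ∈ strings (max n (T k).1) with C (T k) (binNum (initSeg θ k)) x, (M x : ℝ≥0∞) := by
    refine fun k hk => hcov _ _ (Finset.filter_subset _ _) fun ω hω => ?_
    obtain ⟨y, hy, hωy⟩ := Set.mem_iUnion₂.1 (hEF hω)
    refine Set.mem_biUnion (Finset.mem_coe.2 (Finset.mem_filter.2
      ⟨mem_strings.2 (length_initSeg ω _), ?_, ?_⟩)) (mem_interval_initSeg ω _)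
    · rw [mem_interval, mem_strings.1 (hF hy)] at hωy
      rwa [take_initSeg ω (le_max_left _ _), hωy]
    · rw [take_initSeg ω (le_max_right _ _)]
      exact hEK ω hω k hk
  -- Otherwise the supports of `j` and of the true numeral are disjoint, and together their mass is
  -- at least `2p`. Both consist of extensions of strings in `F`, whose total mass is below `2p`.
  have huniq : ∀ k ≥ K, ∀ j, frac p <
      ∑ x ∈ strings (max n (T k).1) with C (T k) j x, (M x : ℝ≥0∞) →
        Near 4 j (binNum (initSeg θ k)) := by
    intro k hk j hj
    by_contra hnear
    have hdisj : Disjoint ((strings (max n (T k).1)).filter (C (T k) j))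
        ((strings (max n (T k).1)).filter (C (T k) (binNum (initSeg θ k)))) := by
      rw [Finset.disjoint_left]
      intro x hx hx'
      exact hnear (near_trans (Finset.mem_filter.1 hx).2.2 (Finset.mem_filter.1 hx').2.2)
    have h1 : ∑ x ∈ strings (max n (T k).1), (if x.take n ∈ F then (M x : ℝ≥0∞) else 0) ≤
        ∑ x ∈ F, (M x : ℝ≥0∞) := by
      refine (antitone_sum_strings (fun x hx => ?_) (le_max_left n (T k).1)).trans (le_of_eq ?_)
      · rw [List.take_append_of_le_length hx, List.take_append_of_le_length hx]
        split_ifs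
        · exact hM.split_le_coe x
        · simp
      · rw [← Finset.sum_filter]
        refine Finset.sum_congr ?_ fun _ _ => rfl
        ext x
        simp only [Finset.mem_filter, mem_strings]
        constructor
        · rintro ⟨rfl, h⟩
          rwa [List.take_length] at h
        · intro h
          have hx := mem_strings.1 (hF h)
          subst hx
          exact ⟨rfl, by rwa [List.take_length]⟩
    have h2 : 2 * frac p ≤ ∑ x ∈ F, (M x : ℝ≥0∞) := by
      rw [two_mul]
      refine (add_le_add hj.le (hθ k hk).le).trans (le_trans ?_ h1)
      rw [← Finset.sum_union hdisj, ← Finset.sum_filter]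
      refine Finset.sum_le_sum_of_subset fun x hx => ?_
      rcases Finset.mem_union.1 hx with h | h <;>
        exact Finset.mem_filter.2 ⟨(Finset.mem_filter.1 h).1, (Finset.mem_filter.1 h).2.1⟩
    exact absurd hlt h2.not_gt
  obtain ⟨J, hJ, hJ'⟩ := exists_computable_choice hre fun k =>
    ⟨_, hθ (k + K) (Nat.le_add_left _ _)⟩
  exact ⟨J, hJ, fun k => huniq (k + K) (Nat.le_add_left _ _) _ (hJ' k)⟩

theorem computable_of_eventually_const {θ : BinSeq} {N : ℕ} {b : Bool}
    (h : ∀ i ≥ N, θ i = b) : Computable θ := by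
  refine (Primrec.to_comp ((Primrec.list_getD b).comp (Primrec.const (initSeg θ N))
    Primrec.id)).of_eq fun i => ?_
  rcases lt_or_ge i N with hi | hi
  · simp [initSeg, hi]
  · simp [initSeg, hi, h i hi]

/-- A digit one keeps the numeral away from the lower end of its dyadic block, and a digit zero from
the upper end. Three further digits enlarge the gap to `8`, twice the tolerance of `Near 4`: once to
pass to the approximation and once to return. -/
theorem exists_binNum_gap {θ : BinSeq} {i t s : ℕ} (ht : i ≤ t) (hs : i ≤ s) (h1 : θ t = true)
    (h0 : θ s = false) {d : ℕ} (hd : s + t + 4 ≤ i + d) :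
    2 ^ d * binNum (initSeg θ i) + 8 ≤ binNum (initSeg θ (i + d)) ∧
      binNum (initSeg θ (i + d)) + 9 ≤ 2 ^ d * (binNum (initSeg θ i) + 1) := by
  constructor
  · obtain ⟨u, rfl⟩ := Nat.exists_eq_add_of_le ht
    obtain ⟨v, rfl⟩ := Nat.exists_eq_add_of_le (show u + 1 + 3 ≤ d by omega)
    have h2 := (binNum_initSeg_add_bounds θ i u).1
    have h3 := binNum_initSeg_succ θ (i + u)
    have h4 := (binNum_initSeg_add_bounds θ (i + u + 1) (3 + v)).1
    rw [h1, Bool.toNat_true] at h3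
    rw [h3, show i + u + 1 + (3 + v) = i + (u + 1 + 3 + v) by ring] at h4
    refine le_trans ?_ h4
    have h5 : 2 ^ (3 + v) * (2 * (2 ^ u * binNum (initSeg θ i)) + 1) ≤
        2 ^ (3 + v) * (2 * binNum (initSeg θ (i + u)) + 1) := by gcongr
    refine le_trans ?_ h5
    have h6 : 8 ≤ 2 ^ (3 + v) := by
      rw [pow_add]; have := Nat.one_le_two_pow (n := v); omega
    calc _ ≤ 2 ^ (u + 1 + 3 + v) * binNum (initSeg θ i) + 2 ^ (3 + v) := by gcongr
      _ = _ := by ring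
  · obtain ⟨u, rfl⟩ := Nat.exists_eq_add_of_le hs
    obtain ⟨v, rfl⟩ := Nat.exists_eq_add_of_le (show u + 1 + 3 ≤ d by omega)
    have h2 := (binNum_initSeg_add_bounds θ i u).2
    have h3 := binNum_initSeg_succ θ (i + u)
    have h4 := (binNum_initSeg_add_bounds θ (i + u + 1) (3 + v)).2
    rw [h0, Bool.toNat_false, add_zero] at h3
    rw [h3, show i + u + 1 + (3 + v) = i + (u + 1 + 3 + v) by ring] at h4
    have h5 : 2 ^ (3 + v) * (2 * (binNum (initSeg θ (i + u)) + 1)) ≤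
        2 ^ (3 + v) * (2 * (2 ^ u * (binNum (initSeg θ i) + 1))) := by gcongr; omega
    have h6 : 8 ≤ 2 ^ (3 + v) := by
      rw [pow_add]; have := Nat.one_le_two_pow (n := v); omega
    have h7 : 2 ^ (u + 1 + 3 + v) * (binNum (initSeg θ i) + 1) =
        2 ^ (3 + v) * (2 * (2 ^ u * (binNum (initSeg θ i) + 1))) := by ring
    rw [h7]
    nlinarith

theorem eq_of_mul_bounds {D x y N : ℕ} (h1 : D * x ≤ N) (h2 : N < D * (x + 1)) (h3 : D * y ≤ N)
    (h4 : N < D * (y + 1)) : x = y := by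
  have h5 := Nat.lt_of_mul_lt_mul_left (h1.trans_lt h4)
  have h6 := Nat.lt_of_mul_lt_mul_left (h3.trans_lt h2)
  omega

/-- A binary sequence is computable if the real number that it represents is. -/
theorem computable_of_near {θ : BinSeq} {J : ℕ → ℕ} (hJ : Computable J) {K : ℕ}
    (h : ∀ k, Near 4 (J k) (binNum (initSeg θ (k + K)))) : Computable θ := by
  -- At a dyadic rational no approximation need ever determine the digits, but then `θ` is
  -- eventually constant. Otherwise both digits recur and the search below terminates.
  by_cases hconst : ∃ N b, ∀ i ≥ N, θ i = b
  · obtain ⟨N, b, hN⟩ := hconst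
    exact computable_of_eventually_const hN
  push Not at hconst
  -- For `y = (i, b, k, d, x)`: the approximation `j` of the numeral of `i + 1 + d` digits lies,
  -- with margin `4`, in the block of the prefix with numeral `2 * x + b`.
  let Q : ℕ × (Bool × ℕ × ℕ × ℕ) → ℕ → Prop := fun y j =>
    y.2.2.1 + K = y.1 + 1 + y.2.2.2.1 ∧
      2 ^ y.2.2.2.1 * (2 * y.2.2.2.2 + y.2.1.toNat) + 4 ≤ j ∧
      j + 4 < 2 ^ y.2.2.2.1 * (2 * y.2.2.2.2 + y.2.1.toNat + 1)
  have hQ : PrimrecPred fun z : (ℕ × (Bool × ℕ × ℕ × ℕ)) × ℕ => Q z.1 z.2 := by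
    have hi : Primrec fun z : (ℕ × (Bool × ℕ × ℕ × ℕ)) × ℕ => z.1.1 :=
      Primrec.fst.comp Primrec.fst
    have hr := (Primrec.snd (α := ℕ) (β := Bool × ℕ × ℕ × ℕ)).comp
      (Primrec.fst (β := ℕ))
    have hk : Primrec fun z : (ℕ × (Bool × ℕ × ℕ × ℕ)) × ℕ => z.1.2.2.1 :=
      Primrec.fst.comp (Primrec.snd.comp hr)
    have hd : Primrec fun z : (ℕ × (Bool × ℕ × ℕ × ℕ)) × ℕ => z.1.2.2.2.1 :=
      Primrec.fst.comp (Primrec.snd.comp (Primrec.snd.comp hr))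
    have hx : Primrec fun z : (ℕ × (Bool × ℕ × ℕ × ℕ)) × ℕ =>
        2 * z.1.2.2.2.2 + z.1.2.1.toNat :=
      Primrec.nat_add.comp (Primrec.nat_double.comp (Primrec.snd.comp (Primrec.snd.comp
        (Primrec.snd.comp hr)))) ((Primrec.dom_bool Bool.toNat).comp (Primrec.fst.comp hr))
    have h2 := primrec_two_pow.comp hd
    exact (Primrec.eq.comp (Primrec.nat_add.comp hk (Primrec.const K))
      (Primrec.nat_add.comp (Primrec.succ.comp hi) hd)).and
      ((Primrec.nat_le.comp (Primrec.nat_add.comp (Primrec.nat_mul.comp h2 hx) (Primrec.const 4))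
        Primrec.snd).and
      (Primrec.nat_lt.comp (Primrec.nat_add.comp Primrec.snd (Primrec.const 4))
        (Primrec.nat_mul.comp h2 (Primrec.succ.comp hx))))
  have hre : REPred fun y : ℕ × (Bool × ℕ × ℕ × ℕ) => Q y (J y.2.2.1) :=
    rePred_comp (rePred_of_primrecPred hQ) (g := fun y => (y, J y.2.2.1))
      (Computable.id.pair (hJ.comp (Computable.fst.comp (Computable.snd.comp Computable.snd))))
  obtain ⟨g, hg, hg'⟩ := exists_computable_choice hre fun i => by
    obtain ⟨t, ht, h1⟩ := hconst (i + 1) false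
    obtain ⟨s, hs, h0⟩ := hconst (i + 1) true
    rw [Bool.ne_false_iff] at h1
    replace h0 := Bool.eq_false_of_not_eq_true h0
    obtain ⟨d, hd⟩ := Nat.exists_eq_add_of_le (show i + 1 ≤ s + t + 4 + K by omega)
    have h2 := exists_binNum_gap ht hs h1 h0 (d := d) (by omega)
    have h3 := h (s + t + 4)
    rw [hd] at h3
    rw [binNum_initSeg_succ θ i] at h2
    refine ⟨(θ i, s + t + 4, d, binNum (initSeg θ i)), hd, ?_, ?_⟩
    · have := h3.2; simp only; omega
    · have := h3.1; simp only; omega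
  refine (Computable.fst.comp hg).of_eq fun i => ?_
  obtain ⟨h1, h2, h3⟩ := hg' i
  have h4 := h (g i).2.1
  simp only at h1 h2 h3
  rw [h1] at h4
  have h5 := binNum_initSeg_add_bounds θ (i + 1) (g i).2.2.1
  -- The true numeral lies in the block that was found and in the block of its own prefix, so these
  -- coincide; parity then identifies the digit.
  have h6 := eq_of_mul_bounds (by have := h4.1; omega) (by have := h4.2; omega) h5.1 h5.2
    (x := 2 * (g i).2.2.2 + (g i).1.toNat)
  rw [binNum_initSeg_succ] at h6
  generalize (g i).1 = b at *
  generalize θ i = c at *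
  cases b <;> cases c <;> simp at h6 ⊢ <;> omega

end ApproximationOfTheParameter

/-- The random set lies in a countable union of sets on which all tables from `K` on are correct, so
one of them is not null. Its `K` is a single number and need not be computed from anything. -/
theorem computable_of_bar_randomSet_pos {M : List Bool → ℝ≥0} (hM : IsUniversal M)
    {Mpar : BinSeq → List Bool → ℝ≥0} (hMpar : IsParamUniversal Mpar)
    {P : BinSeq → Measure BinSeq} (hP : IsComputableFamily P)
    {est : List Bool → Set.Icc (0 : ℝ) 1} (hest : EffectivelyStrictlyConsistent P est)
    {θ : BinSeq} (hθ : 0 < bar M (randomSet Mpar P θ)) : Computable θ := by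
  obtain ⟨T, hTc, hT⟩ := exists_computable_tables hP hest
    (primrec_two_pow.comp Primrec.nat_double_succ)
  let E : ℕ → Set BinSeq := fun K => {ω | ∀ k ≥ K, Correct (T k) k θ (initSeg ω (T k).1)}
  have h1 : randomSet Mpar P θ ⊆ ⋃ K, E K := fun ω hω =>
    Set.mem_iUnion.2 (exists_forall_correct hMpar hP hTc hT hω)
  obtain ⟨K, hK⟩ : ∃ K, 0 < bar M (E K) := by
    by_contra! hne
    have h2 : bar M (⋃ K, E K) = 0 :=
      measure_iUnion_null fun K => le_antisymm (hne K) zero_le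
    exact absurd (hθ.trans_le (measure_mono h1)) (by simp [h2])
  obtain ⟨J, hJ, hJ'⟩ := exists_computable_near hM.semimeasure hM.lower hTc hK
    fun ω hω => hω
  exact computable_of_near hJ hJ'

end AlgRandom

end

open AlgRandom
theorem theorem1
    (M : List Bool → ℝ≥0) (hM : IsUniversal M)
    (Mpar : BinSeq → List Bool → ℝ≥0) (hMpar : IsParamUniversal Mpar)
    (P : BinSeq → MeasureTheory.Measure BinSeq) (hP : IsComputableFamily P)
    (hest : ∃ est : List Bool → Set.Icc (0 : ℝ) 1, EffectivelyStrictlyConsistent P est)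
    (θ : BinSeq) :
    0 < bar M (randomSet Mpar P θ) ↔ Computable θ := by
  obtain ⟨est, hest⟩ := hest
  exact ⟨fun h => computable_of_bar_randomSet_pos hM hMpar hP hest h,
    fun h => bar_randomSet_pos hM hMpar hP h⟩
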